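/- Let $[n]=\{1,\dots,n\}$. A \emph{certificate structure} $\mathcal C$ on $n$ variables is a collection of non-empty families $M\subseteq 2^{[n]}$, each closed under taking supersets. It is \emph{generated} by $\mathcal S\subseteq 2^{[n]}$ if $\mathcal C=\{\{T : S\subseteq T\subseteq[n]\} : S\in\mathcal S\}$. A \emph{learning graph} on $n$ variables is a finite connected acyclic directed graph whose vertices are labelled by subsets of $[n]$ (a non-empty label may be used several times), with a unique vertex labelled $\emptyset$ (the root), whose arcs go only from vertices labelled $S$ to vertices labelled $S\cup\{j\}$ with $j\notin S$, each arc $e$ having a weight $w_e>0$. It is \emph{for} $\mathcal C$ if it is equipped, for each $M\in\mathcal C$, with a real-valued function $p_e(M)$ on arcs such that the sum of $p_e(M)$ over arcs leaving the root is $1$, and, at every vertex with label $S\neq\emptyset$, $S\notin M$, the sum of $p_e(M)$ over incoming arcs equals the sum over outgoing arcs. Its complexity is $\max\bigl\{\sum_e w_e,\ \max_{M\in\mathcal C}\sum_e p_e(M)^2/w_e\bigr\}$. The \emph{learning graph complexity} $\mathcal L(\mathcal C)$ is the infimum of the complexities of the learning graphs for $\mathcal C$. The \emph{quantum query complexity}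 $Q(f)$ of $f\colon[q]^n\to\{0,1\}$ is the smallest number of queries $O_z\colon|j\rangle|v\rangle\mapsto|j\rangle|v+z_j \bmod q\rangle$ (with $0\le j\le n$ and $z_0=0$) made by an algorithm that, starting from $|0\rangle$, alternates input-independent unitaries on finitely many dimensions (with arbitrary workspace) with queries and, on every input $z$, outputs $f(z)$ with probability at least $2/3$. Here the alphabet $[q]$ is identified with the integers modulo $q$. A set $T\subseteq[q]^k$ is an \emph{orthogonal array} of length $k$ and size $|T|$ if, for every $i\in[k]$ and all values of the other $k-1$ entries, there are exactly $|T|/q^{k-1}$ values of the $i$-th entry for which the resulting sequence is in $T$. \textbf{Theorem.} For every $k$ there is a constant $c>0$, depending only on $k$, such that the following holds for all $n$ and $q\ge1$. Let $\mathcal C$ be a certificate structure on $n$ variables generated by a family of non-empty sets of size at most $k$; for $M\in\mathcal C$, let $A_M$ be the set with $M=\{T : A_M\subseteq T\subseteq [n]\}$. Assume $q\ge 2|\mathcal C|$. (a) For each $M\in\mathcal C$, let $T_M$ be an orthogonal array over $[q]$ of length $|A_M|$ and size $q^{|A_M|-1}$, and let $f\colon[q]^n\to\{0,1\}$ be given by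 $f(x)=1$ iff $x_{A_M}\in T_M$ for some $M\in\mathcal C$. Then $Q(f)\ge c\,\mathcal L(\mathcal C)$. (b) In particular, the same bound $Q(f)\ge c\,\mathcal L(\mathcal C)$ holds for the sum problem of $\mathcal C$, defined by $f(x)=1$ iff $\sum_{j\in A_M}x_j\equiv0\pmod q$ for some $M\in\mathcal C$. -/

import Mathlib

open scoped ENNReal

/-! ### Quantum query complexity -/

/-- Labels of the computational basis of a quantum query algorithm on `n` variables over an alphabet
of size `q`: the index register (`0, 1, …, n`), the value register (a `q`-qudit) and the workspace.
The workspace has an arbitrary finite dimension and contains the Boolean output register as its last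
component. -/
abbrev QueryBasis (n q w : ℕ) : Type :=
  Fin (n + 1) × Fin q × Fin (w + 1) × Bool

/-- The input oracle `O_z : |j⟩|v⟩|s⟩ ↦ |j⟩|v + z_j⟩|s⟩` (addition modulo `q`), acting on vectors of
amplitudes.  The input is extended by `z_0 = 0`, so the part with index `0` does not change. -/
def applyOracle {n q w : ℕ} [NeZero q] (z : Fin n → Fin q) (ψ : QueryBasis n q w → ℂ) :
    QueryBasis n q w → ℂ :=
  fun s => ψ (s.1, s.2.1 - (Fin.cons 0 z : Fin (n + 1) → Fin q) s.1, s.2.2)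

/-- A quantum query algorithm making `T` queries,
`U_0 → O_z → U_1 → O_z → ⋯ → U_{T-1} → O_z → U_T`,
where the unitaries `U_i` do not depend on the input. -/
structure QuantumQueryAlgorithm (n q T : ℕ) where
  /-- the workspace is `Fin (workDim + 1) × Bool` -/
  workDim : ℕ
  U : Fin (T + 1) → Matrix.unitaryGroup (QueryBasis n q workDim) ℂ

namespace QuantumQueryAlgorithm

variable {n q T : ℕ} [NeZero q]

/-- The initial state `|0⟩|0⟩|0⟩`. -/
def initialState (𝒜 : QuantumQueryAlgorithm n q T) : QueryBasis n q 𝒜.workDim → ℂ :=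
  Pi.single (0, 0, 0, false) 1

/-- The state on input `z` right after `U_t` has been applied. -/
def state (𝒜 : QuantumQueryAlgorithm n q T) (z : Fin n → Fin q) (t : Fin (T + 1)) :
    QueryBasis n q 𝒜.workDim → ℂ :=
  Fin.induction (motive := fun _ => QueryBasis n q 𝒜.workDim → ℂ)
    ((𝒜.U 0).1.mulVec 𝒜.initialState)
    (fun i ψ => (𝒜.U i.succ).1.mulVec (applyOracle z ψ)) t

/-- The probability that measuring the output register of the final state gives `b`. -/
noncomputable def outputProbability (𝒜 : QuantumQueryAlgorithm n q T) (z : Fin n → Fin q)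
    (b : Bool) : ℝ :=
  ∑ j : Fin (n + 1), ∑ v : Fin q, ∑ u : Fin (𝒜.workDim + 1),
    ‖𝒜.state z (Fin.last T) (j, v, u, b)‖ ^ 2

/-- The algorithm evaluates `f` with bounded error. -/
def Evaluates (𝒜 : QuantumQueryAlgorithm n q T) (f : (Fin n → Fin q) → Bool) : Prop :=
  ∀ z, 2 / 3 ≤ 𝒜.outputProbability z (f z)

end QuantumQueryAlgorithm

/-- The quantum query complexity `Q(f)`: the smallest number of queries made by a quantum query
algorithm that evaluates `f`. -/
noncomputable def quantumQueryComplexity {n q : ℕ} [NeZero q] (f : (Fin n → Fin q) → Bool) : ℕ∞ :=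
  ⨅ (T : ℕ) (_ : ∃ 𝒜 : QuantumQueryAlgorithm n q T, 𝒜.Evaluates f), (T : ℕ∞)

/-! ### Certificate structures -/

/-- A certificate structure on `n` variables: a collection of non-empty families of subsets of the
set of variables, each closed under taking supersets. -/
structure CertificateStructure (n : ℕ) where
  elements : Finset (Finset (Finset (Fin n)))
  nonempty : ∀ M ∈ elements, M.Nonempty
  upward_closed : ∀ M ∈ elements, ∀ S ∈ M, ∀ S', S ⊆ S' → S' ∈ M

/-- The family `{T ∣ S ⊆ T}` of all supersets of `S`. -/
def supersets {n : ℕ} (S : Finset (Fin n)) : Finset (Finset (Fin n)) :=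
  Finset.univ.filter (fun T => S ⊆ T)

namespace CertificateStructure

variable {n : ℕ}

/-- The certificate structure generated by a family `𝒮` of sets of variables. -/
def generatedBy (𝒮 : Finset (Finset (Fin n))) : CertificateStructure n where
  elements := 𝒮.image supersets
  nonempty := by
    intro M hM
    obtain ⟨S, -, rfl⟩ := Finset.mem_image.1 hM
    exact ⟨S, by simp [supersets]⟩
  upward_closed := by
    intro M hM S hS S' hSS'
    obtain ⟨R, -, rfl⟩ := Finset.mem_image.1 hM
    simp only [supersets, Finset.mem_filter, Finset.mem_univ, true_and] at hS ⊢
    exact hS.trans hSS'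

/-- `C` is generated by sets of size at most `k`. -/
def IsBoundedlyGenerated (C : CertificateStructure n) (k : ℕ) : Prop :=
  ∃ 𝒮 : Finset (Finset (Fin n)), C = generatedBy 𝒮 ∧ ∀ S ∈ 𝒮, S.card ≤ k

end CertificateStructure

/-! ### Learning graphs -/

/-- A (finite) learning graph on `n` input variables: a connected directed graph whose vertices are
labelled by sets of variables, with the root as the vertex labelled by `∅`, whose arcs go from
vertices labelled by `S` to vertices labelled by `S ∪ {j}`, `j ∉ S` (so that it is acyclic), and
carry positive weights.  Several vertices may share a non-empty label. -/
structure LearningGraph (n : ℕ) where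
  V : Type
  [fintypeV : Fintype V]
  [decidableEqV : DecidableEq V]
  label : V → Finset (Fin n)
  root : V
  label_eq_empty_iff : ∀ v, label v = ∅ ↔ v = root
  arcs : Finset (V × V)
  arc_loads : ∀ e ∈ arcs, ∃ j, j ∉ label e.1 ∧ label e.2 = insert j (label e.1)
  connected : ∀ v, Relation.EqvGen (fun a b => (a, b) ∈ arcs) root v
  weight : V × V → ℝ
  weight_pos : ∀ e ∈ arcs, 0 < weight e

attribute [instance] LearningGraph.fintypeV LearningGraph.decidableEqV

namespace LearningGraph

variable {n : ℕ}

/-- `p` is a flow on `G` for the family `M` of marked sets: the flow leaving the root is `1`, and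
the flow is conserved at every vertex whose label is non-empty and not marked. -/
structure IsFlow (G : LearningGraph n) (M : Finset (Finset (Fin n))) (p : G.V × G.V → ℝ) :
    Prop where
  root_out : ∑ e ∈ G.arcs with e.1 = G.root, p e = 1
  conservation : ∀ v, G.label v ≠ ∅ → G.label v ∉ M →
    ∑ e ∈ G.arcs with e.2 = v, p e = ∑ e ∈ G.arcs with e.1 = v, p e

/-- The negative complexity `∑ w_e`. -/
def negativeComplexity (G : LearningGraph n) : ℝ :=
  ∑ e ∈ G.arcs, G.weight e

/-- The positive complexity `∑ p_e² / w_e` of a single flow. -/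
noncomputable def positiveComplexity (G : LearningGraph n) (p : G.V × G.V → ℝ) : ℝ :=
  ∑ e ∈ G.arcs, p e ^ 2 / G.weight e

/-- The total complexity of a learning graph for `C`, equipped with the flows `p M`, `M ∈ C`:
the maximum of the negative complexity and of all positive complexities. -/
noncomputable def complexity (G : LearningGraph n) (C : CertificateStructure n)
    (p : Finset (Finset (Fin n)) → G.V × G.V → ℝ) : ℝ :=
  max G.negativeComplexity (⨆ M : C.elements, G.positiveComplexity (p M))

end LearningGraph

/-- The learning graph complexity of `C`: the smallest (infimal) complexity of a learning graph
for `C`, i.e. of a learning graph equipped with a flow for each `M ∈ C`. -/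
noncomputable def learningGraphComplexity {n : ℕ} (C : CertificateStructure n) : ℝ≥0∞ :=
  ⨅ (G : LearningGraph n) (p : Finset (Finset (Fin n)) → G.V × G.V → ℝ)
    (_ : ∀ M ∈ C.elements, G.IsFlow M (p M)), ENNReal.ofReal (G.complexity C p)

/-! ### Orthogonal arrays and the functions they define -/

/-- `T ⊆ [q]^ι` is an orthogonal array (of length `k = |ι|` and strength `k - 1`): for every
position `i` and every choice of the other entries there are exactly `|T| / q^(k-1)` values of the
`i`-th entry that give an element of `T`. -/
def IsOrthogonalArray {ι : Type} [Fintype ι] [DecidableEq ι] {q : ℕ} (T : Finset (ι → Fin q)) :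
    Prop :=
  ∀ (i : ι) (x : ι → Fin q),
    (Finset.univ.filter (fun a : Fin q => Function.update x i a ∈ T)).card *
      q ^ (Fintype.card ι - 1) = T.card

/-- The function with `f x = 1` iff `x_{A_M} ∈ T_M` for some `M ∈ C`. -/
def arrayFunction {n q : ℕ} (C : CertificateStructure n)
    (A : Finset (Finset (Fin n)) → Finset (Fin n))
    (T : (M : Finset (Finset (Fin n))) → Finset (A M → Fin q)) (x : Fin n → Fin q) : Bool :=
  decide (∃ M ∈ C.elements, (fun j : A M => x j) ∈ T M)

/-- The sum problem: `f x = 1` iff `∑_{j ∈ A_M} x_j ≡ 0 (mod q)` for some `M ∈ C`. -/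
def sumFunction {n q : ℕ} (C : CertificateStructure n)
    (A : Finset (Finset (Fin n)) → Finset (Fin n)) (x : Fin n → Fin q) : Bool :=
  decide (∃ M ∈ C.elements, q ∣ ∑ j ∈ A M, (x j : ℕ))

/-!
The learning graph complexity is compared with the quantum query complexity through its dual: the
maximum of `√(∑_M α_∅(M)²)` over potentials `α_S(M)`, vanishing when `S ∈ M`, such that
`∑_M (α_S(M) - α_{S ∪ {j}}(M))² ≤ 1` for all `S` and `j ∉ S`.

*The dual is large* (`exists_dualFeasible_learningGraphComplexity_le`).  The feasible set is compact.
At a maximiser, the Lagrange multipliers `w_e` of the constraints are weights on the arcs of the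
hypercube.  Stationarity in `α_S(M)` says that `w_e (α_S(M) - α_{S ∪ {j}}(M))` is a conserved flow
of value `α_∅(M)`, complementary slackness turns `∑ w_e` into the total energy `∑_M α_∅(M)²`, and the
energy of each unit flow is `1`.  Rescaling the weights balances the two complexities.  Since some
`α_∅(M)` may vanish, a small linear term is added to the objective, which costs an arbitrarily small
error.

*Dual solutions bound queries from below* (`sqrt_sum_sq_le_of_evaluates`).  Let `E_S` be the
projection of `ℝ^([q]^n)` onto the functions that depend only on the coordinates in `S` and have zero
mean in each of them.  The adversary matrix has the blocks `√q ∑_S α_S(M) E_S`, with the rows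
restricted to the set `X_M` of inputs satisfying the condition of `M` and the columns to the negative
inputs.  Off the diagonal in coordinate `j` the kernels of `E_S` and `E_{S ∪ {j}}` are opposite, so
for a query to `x_j` the coefficients can be replaced by `α_S(M) - α_{S ∪ {j}}(M)` for `j ∉ S` and `0`
for `j ∈ S`.  If `i ∈ A_M \ S`, the range of `E_S` consists of functions independent of `x_i`, and by
the orthogonal array property the restriction of such functions to `X_M`, scaled by `√q`, is an
isometry (`IsUniqueAt.mul_sum`).  Splitting the sum over `S` according to a missing `i ∈ A_M`
bounds the norm after the replacement in terms of `k` (`mul_sum_sq_sum_proj_le`).  On the other hand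
the uniform vector on `X_M` is orthogonal to the range of `E_S` for all relevant `S ≠ ∅`, so that
vectors uniform on the `X_M` and on the negative inputs, at least half of all inputs, show that the
norm of the adversary matrix is at least `√(∑_M α_∅(M)²) / 2`.  The negative-weight adversary method
(`QuantumQueryAlgorithm.adversary_bound`) compares the two norms.
-/

/-! ### Lagrange multipliers -/

/-- Gordan's alternative: finitely many linear functionals without a common direction of strict
increase have a non-trivial non-negative linear dependency. -/
theorem exists_nonneg_dependency_of_no_common_ascent {E I : Type*} [AddCommGroup E] [Module ℝ E]
    [Fintype I] (φ : I → E →ₗ[ℝ] ℝ) (h : ¬ ∃ d, ∀ i, 0 < φ i d) :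
    ∃ c : I → ℝ, (∀ i, 0 ≤ c i) ∧ (∃ i, c i ≠ 0) ∧ ∀ d, ∑ i, c i * φ i d = 0 := by
  classical
  have hs : IsOpen {x : I → ℝ | ∀ i, 0 < x i} := by
    simp only [Set.ofPred_forall]
    exact isOpen_iInter_of_finite fun i => isOpen_lt continuous_const (continuous_apply i)
  have hsc : Convex ℝ {x : I → ℝ | ∀ i, 0 < x i} := by
    simp only [Set.ofPred_forall]
    exact convex_iInter fun i => convex_halfSpace_gt (LinearMap.proj i : (I → ℝ) →ₗ[ℝ] ℝ).isLinear 0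
  have hdisj : Disjoint {x : I → ℝ | ∀ i, 0 < x i}
      (LinearMap.range (LinearMap.pi φ) : Set (I → ℝ)) := by
    rw [Set.disjoint_left]
    rintro _ hx ⟨d, rfl⟩
    exact h ⟨d, hx⟩
  obtain ⟨f, u, hf, hu⟩ := geometric_hahn_banach_open hsc hs
    (LinearMap.range (LinearMap.pi φ)).convex hdisj
  have hu0 : u ≤ 0 := by simpa using hu 0 (Submodule.zero_mem _)
  have hexp : ∀ x : I → ℝ, f x = ∑ i, x i * f (Pi.single i 1) := by
    intro x
    conv_lhs => rw [pi_eq_sum_univ' x]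
    rw [map_sum]
    refine Finset.sum_congr rfl fun i _ => ?_
    rw [map_smul, smul_eq_mul]
  have hone : f 1 < 0 := (hf 1 (fun i => by simp)).trans_le hu0
  refine ⟨fun i => - f (Pi.single i 1), fun i => ?_, ?_, fun d => ?_⟩
  · by_contra hneg
    have hpos : 0 < f (Pi.single i 1) := by linarith
    have hmem : (1 + (-(f 1) / f (Pi.single i 1)) • Pi.single i 1 : I → ℝ) ∈
        {x : I → ℝ | ∀ i, 0 < x i} := by
      intro j
      have : 0 ≤ -(f 1) / f (Pi.single i 1) := div_nonneg (by linarith) hpos.le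
      by_cases hij : j = i
      · subst hij
        simp only [Pi.add_apply, Pi.one_apply, Pi.smul_apply, Pi.single_eq_same, smul_eq_mul]
        linarith
      · simp [hij]
    have := hf _ hmem
    rw [map_add, map_smul, smul_eq_mul, div_mul_cancel₀ _ hpos.ne'] at this
    linarith
  · by_contra hz
    push Not at hz
    have : f 1 = 0 := by
      rw [hexp]
      exact Finset.sum_eq_zero fun i _ => by rw [neg_eq_zero.1 (hz i), mul_zero]
    linarith
  · have hzero : f (LinearMap.pi φ d) = 0 := by
      by_contra hne
      have := hu (LinearMap.pi φ (((u - 1) / f (LinearMap.pi φ d)) • d)) ⟨_, rfl⟩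
      rw [map_smul, map_smul, smul_eq_mul, div_mul_cancel₀ _ hne] at this
      linarith
    rw [hexp] at hzero
    simp only [LinearMap.pi_apply] at hzero
    rw [← neg_eq_zero, ← Finset.sum_neg_distrib, ← hzero]
    exact Finset.sum_congr rfl fun i _ => by ring

/-- Lagrange multipliers for the maximum of a convex quadratic function on an intersection of
ellipsoids.  The multiplier of the objective can be normalised because pairing a dependency among
the constraint gradients alone with the maximiser itself would give `∑ w_e = 0`. -/
theorem exists_multipliers_of_isMax {E ι μ : Type*} [AddCommGroup E] [Module ℝ E] [Fintype ι]
    [Fintype μ] (A : μ → E →ₗ[ℝ] ℝ) (b : μ → ℝ) (D : ι → μ → E →ₗ[ℝ] ℝ) (α : E)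
    (hα : ∀ e, ∑ m, D e m α ^ 2 ≤ 1)
    (hmax : ∀ β, (∀ e, ∑ m, D e m β ^ 2 ≤ 1) →
      ∑ m, (A m β ^ 2 + 2 * b m * A m β) ≤ ∑ m, (A m α ^ 2 + 2 * b m * A m α)) :
    ∃ w : ι → ℝ, (∀ e, 0 ≤ w e) ∧ (∀ e, w e ≠ 0 → ∑ m, D e m α ^ 2 = 1) ∧
      ∀ d, ∑ m, (A m α + b m) * A m d = ∑ e, w e * ∑ m, D e m α * D e m d := by
  classical
  let act := {e : ι // ∑ m, D e m α ^ 2 = 1}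
  let g : ι → E →ₗ[ℝ] ℝ := fun e => ∑ m, (D e m α) • D e m
  have hg : ∀ e d, g e d = ∑ m, D e m α * D e m d := fun e d => by simp [g]
  let φ : Option act → E →ₗ[ℝ] ℝ := fun o => o.elim (∑ m, (A m α + b m) • A m) (fun e => - g e.1)
  have hφ0 : ∀ d, φ none d = ∑ m, (A m α + b m) * A m d := fun d => by simp [φ]
  have hφ1 : ∀ e d, φ (some e) d = - g e.1 d := fun e d => by simp [φ]
  have hno : ¬ ∃ d, ∀ o, 0 < φ o d := by
    rintro ⟨d, hd⟩
    have hexp : ∀ e (t : ℝ), ∑ m, D e m (α + t • d) ^ 2 =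
        ∑ m, D e m α ^ 2 + t * (2 * g e d + t * ∑ m, D e m d ^ 2) := by
      intro e t
      simp only [hg, map_add, map_smul, smul_eq_mul, Finset.mul_sum, mul_add, ← Finset.sum_add_distrib]
      exact Finset.sum_congr rfl fun m _ => by ring
    have hev : ∀ e, ∀ᶠ t in nhdsWithin (0 : ℝ) (Set.Ioi 0), ∑ m, D e m (α + t • d) ^ 2 ≤ 1 := by
      intro e
      by_cases he : ∑ m, D e m α ^ 2 = 1
      · have hneg : g e d < 0 := by
          have := hd (some ⟨e, he⟩)
          rw [hφ1] at this
          simpa using this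
        have hc : Filter.Tendsto (fun t : ℝ => 2 * g e d + t * ∑ m, D e m d ^ 2)
            (nhdsWithin 0 (Set.Ioi 0)) (nhds (2 * g e d + 0 * ∑ m, D e m d ^ 2)) :=
          (Continuous.tendsto (by fun_prop) 0).mono_left nhdsWithin_le_nhds
        filter_upwards [hc.eventually (gt_mem_nhds (show _ < (0 : ℝ) by linarith)),
          self_mem_nhdsWithin] with t ht htpos
        rw [hexp, he]
        nlinarith [mul_neg_of_pos_of_neg (Set.mem_Ioi.1 htpos) ht]
      · have hlt := lt_of_le_of_ne (hα e) he
        have hc : Filter.Tendsto (fun t : ℝ => ∑ m, D e m (α + t • d) ^ 2)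
            (nhdsWithin 0 (Set.Ioi 0)) (nhds (∑ m, D e m α ^ 2)) := by
          have : Continuous fun t : ℝ => ∑ m, D e m (α + t • d) ^ 2 := by
            simp only [hexp]; fun_prop
          have h2 := this.tendsto 0
          simp only [zero_smul, add_zero] at h2
          exact h2.mono_left nhdsWithin_le_nhds
        filter_upwards [hc.eventually (gt_mem_nhds hlt)] with t ht using ht.le
    obtain ⟨t, ht, htpos⟩ := ((Filter.eventually_all.2 hev).and self_mem_nhdsWithin).exists
    have hm := hmax _ ht
    have hobj : ∑ m, (A m (α + t • d) ^ 2 + 2 * b m * A m (α + t • d)) =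
        ∑ m, (A m α ^ 2 + 2 * b m * A m α) + 2 * t * φ none d + ∑ m, (t * A m d) ^ 2 := by
      rw [hφ0]
      simp only [map_add, map_smul, smul_eq_mul, Finset.mul_sum, ← Finset.sum_add_distrib]
      exact Finset.sum_congr rfl fun m _ => by ring
    rw [hobj] at hm
    have h1 : 0 < 2 * t * φ none d := mul_pos (mul_pos two_pos htpos) (hd none)
    have h2 : 0 ≤ ∑ m, (t * A m d) ^ 2 := Finset.sum_nonneg fun m _ => sq_nonneg _
    linarith
  obtain ⟨c, hc0, ⟨i, hi⟩, hc⟩ := exists_nonneg_dependency_of_no_common_ascent φ hno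
  simp only [Fintype.sum_option, hφ0, hφ1] at hc
  have hcn : 0 < c none := by
    refine lt_of_le_of_ne (hc0 none) fun h0 => ?_
    have := hc α
    rw [← h0, zero_mul, zero_add] at this
    have hsum : ∑ e : act, c (some e) = 0 := by
      rw [← neg_eq_zero, ← this, ← Finset.sum_neg_distrib]
      refine Finset.sum_congr rfl fun e _ => ?_
      have : g e.1 α = 1 := by
        rw [hg]
        exact (Finset.sum_congr rfl fun m _ => (sq _).symm).trans e.2
      rw [this]; ring
    rw [Finset.sum_eq_zero_iff_of_nonneg fun e _ => hc0 _] at hsum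
    rcases i with _ | e
    · exact hi h0.symm
    · exact hi (hsum e (Finset.mem_univ _))
  refine ⟨fun e => if he : ∑ m, D e m α ^ 2 = 1 then c (some ⟨e, he⟩) / c none else 0, ?_, ?_, ?_⟩
  · intro e
    dsimp only
    split_ifs
    · exact div_nonneg (hc0 _) hcn.le
    · exact le_rfl
  · intro e he
    by_contra h
    simp [h] at he
  · intro d
    have h1 := hc d
    have h2 : ∑ e, (if he : ∑ m, D e m α ^ 2 = 1 then c (some ⟨e, he⟩) / c none else 0) *
        ∑ m, D e m α * D e m d = ∑ e : act, c (some e) / c none * g e.1 d := by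
      rw [← Finset.sum_filter_of_ne (p := fun e => ∑ m, D e m α ^ 2 = 1),
        Finset.sum_subtype (p := fun e => ∑ m, D e m α ^ 2 = 1) _ (by simp)]
      · exact Finset.sum_congr rfl fun e _ => by rw [dif_pos e.2, hg]
      · intro e _ hne
        by_contra he
        simp [he] at hne
    rw [h2]
    have h3 : ∑ e : act, c (some e) / c none * g e.1 d
        = - (∑ e : act, c (some e) * - g e.1 d) / c none := by
      rw [← Finset.sum_neg_distrib, Finset.sum_div]
      exact Finset.sum_congr rfl fun e _ => by ring
    rw [h3, eq_div_iff hcn.ne']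
    linarith

/-! ### Duality for learning graphs -/

/-- The learning graph with exactly one vertex for every set of variables and all possible arcs. -/
def hypercubeLearningGraph (n : ℕ) (w : Finset (Fin n) × Finset (Fin n) → ℝ)
    (hw : ∀ e, 0 < w e) : LearningGraph n where
  V := Finset (Fin n)
  label := id
  root := ∅
  label_eq_empty_iff := fun _ => Iff.rfl
  arcs := Finset.univ.filter fun e => ∃ j, j ∉ e.1 ∧ e.2 = insert j e.1
  arc_loads := fun e he => (Finset.mem_filter.1 he).2
  connected := by
    intro v
    induction v using Finset.induction_on with
    | empty => exact Relation.EqvGen.refl _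
    | insert j S hj ih =>
      exact ih.trans _ _ _
        (Relation.EqvGen.rel _ _ (Finset.mem_filter.2 ⟨Finset.mem_univ _, j, hj, rfl⟩))
  weight := w
  weight_pos := fun e _ => hw e

/-- Feasible points of the dual of the learning graph complexity: potentials `α_S(M)` vanishing when
`S ∈ M`, whose differences along any arc of the hypercube have total square at most `1`. -/
structure IsDualFeasible {n : ℕ} (C : CertificateStructure n)
    (α : Finset (Fin n) → Finset (Finset (Fin n)) → ℝ) : Prop where
  eq_zero_of_mem : ∀ M ∈ C.elements, ∀ S ∈ M, α S M = 0
  sum_sq_sub_le : ∀ S, ∀ j ∉ S, ∑ M ∈ C.elements, (α S M - α (insert j S) M) ^ 2 ≤ 1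

namespace CertificateStructure

variable {n : ℕ} (C : CertificateStructure n)

/-- The free coordinates of a dual point: pairs `(S, M)` with `S ∉ M`. -/
abbrev DualIndex : Type :=
  {p : Finset (Fin n) × C.elements // p.1 ∉ p.2.1}

/-- The value `α_S(M)` of a dual point, which is zero when `S ∈ M`. -/
def dualValue (S : Finset (Fin n)) (M : C.elements) : (C.DualIndex → ℝ) →ₗ[ℝ] ℝ :=
  if h : S ∉ M.1 then LinearMap.proj (⟨(S, M), h⟩ : C.DualIndex) else 0

/-- The arcs of the hypercube. -/
abbrev Arc (n : ℕ) : Type :=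
  {e : Finset (Fin n) × Finset (Fin n) // ∃ j, j ∉ e.1 ∧ e.2 = insert j e.1}

/-- The difference of the values of a dual point along an arc. -/
def dualDiff (e : Arc n) (M : C.elements) : (C.DualIndex → ℝ) →ₗ[ℝ] ℝ :=
  C.dualValue e.1.1 M - C.dualValue e.1.2 M

variable {C}

theorem dualValue_of_mem {S : Finset (Fin n)} {M : C.elements} (h : S ∈ M.1)
    (α : C.DualIndex → ℝ) : C.dualValue S M α = 0 := by
  simp [dualValue, h]

theorem dualValue_of_notMem {S : Finset (Fin n)} {M : C.elements} (h : S ∉ M.1)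
    (α : C.DualIndex → ℝ) : C.dualValue S M α = α ⟨(S, M), h⟩ := by
  simp [dualValue, h]

theorem dualValue_single (S R : Finset (Fin n)) (M N : C.elements) (h : R ∉ N.1) :
    C.dualValue S M (Pi.single ⟨(R, N), h⟩ 1) = if S = R ∧ M = N then 1 else 0 := by
  classical
  by_cases hS : S ∈ M.1
  · rw [dualValue_of_mem hS, if_neg]
    rintro ⟨rfl, rfl⟩
    exact h hS
  · rw [dualValue_of_notMem hS]
    simp [Pi.single_apply]

theorem abs_dualDiff_le_one {α : C.DualIndex → ℝ} (hα : ∀ e, ∑ M, C.dualDiff e M α ^ 2 ≤ 1)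
    (e : Arc n) (M : C.elements) : |C.dualDiff e M α| ≤ 1 := by
  rw [← sq_le_one_iff_abs_le_one]
  exact (Finset.single_le_sum (f := fun M => C.dualDiff e M α ^ 2) (fun _ _ => sq_nonneg _)
    (Finset.mem_univ M)).trans (hα e)

/-- Following arcs up to the full set, where every potential vanishes, bounds a feasible point. -/
theorem abs_dualValue_le {α : C.DualIndex → ℝ} (hα : ∀ e, ∑ M, C.dualDiff e M α ^ 2 ≤ 1)
    (M : C.elements) (S : Finset (Fin n)) : |C.dualValue S M α| ≤ n := by
  have key : ∀ (m : ℕ) (S : Finset (Fin n)), Sᶜ.card = m → |C.dualValue S M α| ≤ m := by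
    intro m
    induction m with
    | zero =>
      intro S hS
      have hS' : S = Finset.univ := by simpa using hS
      obtain ⟨R, hR⟩ := C.nonempty M.1 M.2
      rw [hS', dualValue_of_mem (C.upward_closed M.1 M.2 R hR _ (Finset.subset_univ _))]
      simp
    | succ m ih =>
      intro S hS
      obtain ⟨j, hj⟩ : Sᶜ.Nonempty := Finset.card_pos.1 (by omega)
      have hjS : j ∉ S := Finset.mem_compl.1 hj
      have h1 := ih (insert j S) (by
        rw [Finset.compl_insert, Finset.card_erase_of_mem hj, hS]; rfl)
      have h2 := abs_dualDiff_le_one hα ⟨(S, insert j S), j, hjS, rfl⟩ M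
      simp only [dualDiff, LinearMap.sub_apply] at h2
      push_cast
      rw [abs_le] at *
      constructor <;> linarith [h1.1, h1.2, h2.1, h2.2]
  refine (key _ S rfl).trans ?_
  exact_mod_cast (Finset.card_le_univ _).trans (by simp)

theorem isCompact_dualFeasible :
    IsCompact {α : C.DualIndex → ℝ | ∀ e, ∑ M, C.dualDiff e M α ^ 2 ≤ 1} := by
  have hc : ∀ e M, Continuous (C.dualDiff e M) :=
    fun e M => LinearMap.continuous_of_finiteDimensional _
  refine Metric.isCompact_of_isClosed_isBounded ?_ ?_
  · simp only [Set.ofPred_forall]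
    exact isClosed_iInter fun e => isClosed_le (by fun_prop) continuous_const
  · refine (Metric.isBounded_closedBall (x := (0 : C.DualIndex → ℝ)) (r := n)).subset fun α hα => ?_
    rw [mem_closedBall_zero_iff, pi_norm_le_iff_of_nonneg (Nat.cast_nonneg n)]
    rintro ⟨⟨S, M⟩, h⟩
    have := abs_dualValue_le hα M S
    rwa [dualValue_of_notMem h] at this

/-- A maximiser of `∑_M α_∅(M)² + 2δ α_∅(M)` over the dual feasible points has `α_∅(M) ≥ 0` for
all `M`, since otherwise the sign of `α(M)` could be changed. -/
theorem exists_dual_maximizer {δ : ℝ} (hδ : 0 < δ) :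
    ∃ α : C.DualIndex → ℝ, (∀ e, ∑ M, C.dualDiff e M α ^ 2 ≤ 1) ∧
      (∀ M, 0 ≤ C.dualValue ∅ M α) ∧
      ∀ β, (∀ e, ∑ M, C.dualDiff e M β ^ 2 ≤ 1) →
        ∑ M, (C.dualValue ∅ M β ^ 2 + 2 * δ * C.dualValue ∅ M β) ≤
          ∑ M, (C.dualValue ∅ M α ^ 2 + 2 * δ * C.dualValue ∅ M α) := by
  have hc : ∀ S M, Continuous (C.dualValue S M) :=
    fun e M => LinearMap.continuous_of_finiteDimensional _
  obtain ⟨α, hα, hmax⟩ := (isCompact_dualFeasible (C := C)).exists_isMaxOn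
    ⟨0, fun e => by simp⟩
    (f := fun β => ∑ M, (C.dualValue ∅ M β ^ 2 + 2 * δ * C.dualValue ∅ M β))
    (Continuous.continuousOn (by fun_prop))
  refine ⟨α, hα, fun M₀ => ?_, fun β hβ => hmax hβ⟩
  by_contra! hneg
  let β : C.DualIndex → ℝ := fun p => if p.1.2 = M₀ then - α p else α p
  have hβ : ∀ S M, C.dualValue S M β = if M = M₀ then - C.dualValue S M α else C.dualValue S M α := by
    intro S M
    by_cases hS : S ∈ M.1
    · simp [dualValue_of_mem hS]
    · simp [dualValue_of_notMem hS, β]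
  have hfeas : ∀ e, ∑ M, C.dualDiff e M β ^ 2 ≤ 1 := by
    intro e
    refine le_trans (le_of_eq (Finset.sum_congr rfl fun M _ => ?_)) (hα e)
    simp only [dualDiff, LinearMap.sub_apply, hβ]
    split_ifs <;> ring
  refine absurd (Set.mem_ofPred.1 (hmax hfeas)) (not_le.2 ?_)
  refine Finset.sum_lt_sum (fun M _ => ?_) ⟨M₀, Finset.mem_univ _, ?_⟩
  · rw [hβ]
    split_ifs with h
    · subst h; nlinarith
    · rfl
  · rw [hβ, if_pos rfl]; nlinarith

end CertificateStructure

open CertificateStructure in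
/-- Weak form of the strong duality for learning graphs.  The Lagrange multipliers of the dual
optimum are the weights of an optimal learning graph, and the potential differences multiplied by
the weights are its flows.  The linear term with `δ` keeps the flows from vanishing, and `η` keeps
the weights positive. -/
theorem exists_learningGraph_of_dual {n : ℕ} {C : CertificateStructure n}
    (hC : ∀ M ∈ C.elements, ∅ ∉ M) {δ η : ℝ} (hδ : 0 < δ) (hη : 0 < η) :
    ∃ α, IsDualFeasible C α ∧ ∃ w : Finset (Fin n) × Finset (Fin n) → ℝ, ∃ hw : ∀ e, 0 < w e,
      (hypercubeLearningGraph n w hw).negativeComplexity ≤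
        ∑ M ∈ C.elements, α ∅ M * (α ∅ M + δ) + η * Fintype.card (Arc n) ∧
      (∀ M ∈ C.elements, 0 ≤ α ∅ M ∧ α ∅ M ≤ n) ∧
      ∃ p : Finset (Finset (Fin n)) → Finset (Fin n) × Finset (Fin n) → ℝ, ∀ M ∈ C.elements,
        (hypercubeLearningGraph n w hw).IsFlow M (p M) ∧
        (hypercubeLearningGraph n w hw).positiveComplexity (p M) ≤ 1 := by
  obtain ⟨α, hα, hnn, hmax⟩ := exists_dual_maximizer (C := C) hδ
  obtain ⟨w, hw0, hw1, hw⟩ := exists_multipliers_of_isMax (fun M => C.dualValue ∅ M) (fun _ => δ)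
    (fun e M => C.dualDiff e M) α hα hmax
  let a : Finset (Fin n) → Finset (Finset (Fin n)) → ℝ := fun S M =>
    if h : M ∈ C.elements then C.dualValue S ⟨M, h⟩ α else 0
  have ha : ∀ S (M : C.elements), a S M = C.dualValue S M α := fun S M => by simp [a]
  -- Pairing the stationarity condition with a coordinate vector gives flow conservation.
  have hflow : ∀ (v : Finset (Fin n)) (M : C.elements), v ∉ M.1 →
      (if ∅ = v then C.dualValue ∅ M α + δ else 0) =
        ∑ e : Arc n, (if e.1.1 = v then w e * C.dualDiff e M α else 0) -
          ∑ e : Arc n, (if e.1.2 = v then w e * C.dualDiff e M α else 0) := by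
    intro v M hv
    have h := hw (Pi.single ⟨(v, M), hv⟩ 1)
    simp only [dualDiff, LinearMap.sub_apply, dualValue_single] at h
    rw [Finset.sum_eq_single M (by intro N _ hN; simp [hN]) (by simp)] at h
    rw [← Finset.sum_sub_distrib]
    refine Eq.trans ?_ (h.trans (Finset.sum_congr rfl fun e _ => ?_))
    · simp
    · rw [Finset.sum_eq_single M (by intro N _ hN; simp [hN]) (by simp)]
      simp only [and_true, dualDiff, LinearMap.sub_apply]
      split_ifs <;> ring
  -- Pairing it with the part of `α` that belongs to one `M` computes the energy of the flow.
  have henergy : ∀ M : C.elements, (C.dualValue ∅ M α + δ) * C.dualValue ∅ M α =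
      ∑ e : Arc n, w e * C.dualDiff e M α ^ 2 := by
    intro M
    have hβ : ∀ S N, C.dualValue S N (fun p => if p.1.2 = M then α p else 0) =
        if N = M then C.dualValue S N α else 0 := by
      intro S N
      by_cases hS : S ∈ N.1
      · simp [dualValue_of_mem hS]
      · simp [dualValue_of_notMem hS]
    have h := hw (fun p => if p.1.2 = M then α p else 0)
    simp only [dualDiff, LinearMap.sub_apply, hβ] at h
    rw [Finset.sum_eq_single M (by intro N _ hN; simp [hN]) (by simp)] at h
    rw [if_pos rfl] at h
    refine h.trans (Finset.sum_congr rfl fun e _ => ?_)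
    rw [Finset.sum_eq_single M (by intro N _ hN; simp [hN]) (by simp)]
    simp only [if_true, dualDiff, LinearMap.sub_apply]
    ring
  have hweight : ∑ e : Arc n, w e = ∑ M : C.elements, C.dualValue ∅ M α * (C.dualValue ∅ M α + δ) := by
    simp only [mul_comm (C.dualValue ∅ _ α), henergy]
    rw [Finset.sum_comm]
    refine Finset.sum_congr rfl fun e _ => ?_
    rw [← Finset.mul_sum]
    by_cases he : w e = 0
    · simp [he]
    · rw [hw1 e he, mul_one]
  let w' : Finset (Fin n) × Finset (Fin n) → ℝ := fun e =>
    (if h : ∃ j, j ∉ e.1 ∧ e.2 = insert j e.1 then w ⟨e, h⟩ else 0) + η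
  have hw' : ∀ e, 0 < w' e := by
    intro e
    simp only [w']
    split_ifs with h
    · linarith [hw0 ⟨e, h⟩]
    · linarith
  have hw'e : ∀ e : Arc n, w' e.1 = w e + η := fun e => by simp only [w']; rw [dif_pos e.2]
  let p : Finset (Finset (Fin n)) → Finset (Fin n) × Finset (Fin n) → ℝ := fun M e =>
    if h : (∃ j, j ∉ e.1 ∧ e.2 = insert j e.1) ∧ M ∈ C.elements then
      w ⟨e, h.1⟩ * C.dualDiff ⟨e, h.1⟩ ⟨M, h.2⟩ α / (C.dualValue ∅ ⟨M, h.2⟩ α + δ) else 0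
  have hp : ∀ (M : C.elements) (e : Arc n), p M.1 e.1 =
      w e * C.dualDiff e M α / (C.dualValue ∅ M α + δ) := fun M e => by
    simp only [p]; rw [dif_pos ⟨e.2, M.2⟩]
  have hsum : ∀ F : Finset (Fin n) × Finset (Fin n) → ℝ,
      ∑ e ∈ (hypercubeLearningGraph n w' hw').arcs, F e = ∑ e : Arc n, F e.1 := fun F =>
    Finset.sum_subtype _ (fun e => by simp [hypercubeLearningGraph]) F
  refine ⟨a, ⟨?_, ?_⟩, w', hw', ?_, ?_, p, ?_⟩
  · intro M hM S hS
    rw [ha S ⟨M, hM⟩, dualValue_of_mem hS]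
  · intro S j hj
    rw [← Finset.sum_coe_sort]
    simp only [ha]
    exact hα ⟨(S, insert j S), j, hj, rfl⟩
  · refine le_of_eq ?_
    unfold LearningGraph.negativeComplexity
    refine (hsum w').trans ?_
    simp only [hw'e]
    rw [Finset.sum_add_distrib, hweight,
      ← Finset.sum_coe_sort C.elements (fun M => a ∅ M * (a ∅ M + δ))]
    simp only [ha]
    simp [mul_comm]
  · intro M hM
    rw [ha ∅ ⟨M, hM⟩]
    exact ⟨hnn _, (le_abs_self _).trans (abs_dualValue_le hα _ _)⟩
  · intro M' hM'
    obtain ⟨M, rfl⟩ : ∃ M : C.elements, M.1 = M' := ⟨⟨M', hM'⟩, rfl⟩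
    have hpos : 0 < C.dualValue ∅ M α + δ := by linarith [hnn M]
    have hout : ∀ v : Finset (Fin n), ∑ e ∈ (hypercubeLearningGraph n w' hw').arcs
        with e.1 = v, p M e = (∑ e : Arc n, (if e.1.1 = v then w e * C.dualDiff e M α else 0)) /
          (C.dualValue ∅ M α + δ) := by
      intro v
      rw [Finset.sum_filter, Finset.sum_div]
      refine (hsum fun e => if e.1 = v then p M e else 0).trans
        (Finset.sum_congr rfl fun e _ => ?_)
      rw [hp]
      split_ifs <;> simp
    have hin : ∀ v : Finset (Fin n), ∑ e ∈ (hypercubeLearningGraph n w' hw').arcs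
        with e.2 = v, p M e = (∑ e : Arc n, (if e.1.2 = v then w e * C.dualDiff e M α else 0)) /
          (C.dualValue ∅ M α + δ) := by
      intro v
      rw [Finset.sum_filter, Finset.sum_div]
      refine (hsum fun e => if e.2 = v then p M e else 0).trans
        (Finset.sum_congr rfl fun e _ => ?_)
      rw [hp]
      split_ifs <;> simp
    refine ⟨⟨?_, ?_⟩, ?_⟩
    · refine (hout ∅).trans ?_
      have h := hflow ∅ M (hC _ M.2)
      have h0 : ∑ e : Arc n, (if e.1.2 = ∅ then w e * C.dualDiff e M α else 0) = 0 := by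
        refine Finset.sum_eq_zero fun e _ => if_neg ?_
        obtain ⟨j, -, he⟩ := e.2
        rw [he]
        exact Finset.insert_ne_empty _ _
      rw [h0, sub_zero, if_pos rfl] at h
      rw [← h, div_self hpos.ne']
    · intro v hv hvM
      have h := hflow v M hvM
      have hv' : ∅ ≠ (show Finset (Fin n) from v) := Ne.symm hv
      rw [if_neg hv'] at h
      exact (hin v).trans (Eq.trans (by rw [sub_eq_zero.1 h.symm]) (hout v).symm)
    · unfold LearningGraph.positiveComplexity
      refine (hsum fun e => p M e ^ 2 / w' e).trans_le ?_
      have : ∀ e : Arc n, p M e.1 ^ 2 / w' e.1 ≤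
          w e * C.dualDiff e M α ^ 2 / (C.dualValue ∅ M α + δ) ^ 2 := by
        intro e
        rw [hp, hw'e, div_pow, div_div, mul_comm (_ ^ 2) (w e + η), ← div_div]
        refine div_le_div_of_nonneg_right ?_ (sq_nonneg _)
        rw [div_le_iff₀ (by linarith [hw0 e])]
        have := mul_nonneg (mul_nonneg (hw0 e) (sq_nonneg (C.dualDiff e M α))) hη.le
        nlinarith
      refine (Finset.sum_le_sum fun e _ => this e).trans ?_
      rw [← Finset.sum_div, ← henergy, div_le_one (by positivity)]
      nlinarith [hnn M]

/-- The learning graph complexity is at most the dual optimum.  The weights of a learning graph with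
negative complexity about `∑_M α_∅(M)²` and positive complexity at most `1` are rescaled so that both
become the square root of the former. -/
theorem exists_dualFeasible_learningGraphComplexity_le {n : ℕ} {C : CertificateStructure n}
    (hC : ∀ M ∈ C.elements, ∅ ∉ M) {ε : ℝ} (hε : 0 < ε) :
    ∃ α, IsDualFeasible C α ∧ learningGraphComplexity C ≤
      ENNReal.ofReal √(∑ M ∈ C.elements, α ∅ M ^ 2 + ε) := by
  have hδ : 0 < ε / (2 * (C.elements.card * n + 1)) := by positivity
  have hη : 0 < ε / (2 * (Fintype.card (CertificateStructure.Arc n) + 1 : ℝ)) := by positivity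
  obtain ⟨α, hα, w, hw, hneg, hb, p, hp⟩ := exists_learningGraph_of_dual hC hδ hη
  set δ := ε / (2 * (C.elements.card * n + 1 : ℝ)) with hδdef
  set η := ε / (2 * (Fintype.card (CertificateStructure.Arc n) + 1 : ℝ)) with hηdef
  refine ⟨α, hα, ?_⟩
  have h1 : ∑ M ∈ C.elements, α ∅ M * (α ∅ M + δ) ≤ ∑ M ∈ C.elements, α ∅ M ^ 2 + ε / 2 := by
    have : ∑ M ∈ C.elements, α ∅ M * (α ∅ M + δ) ≤ ∑ M ∈ C.elements, (α ∅ M ^ 2 + n * δ) := by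
      refine Finset.sum_le_sum fun M hM => ?_
      nlinarith [hb M hM]
    refine this.trans ?_
    rw [Finset.sum_add_distrib, Finset.sum_const, nsmul_eq_mul]
    gcongr
    rw [hδdef, ← mul_assoc, mul_div_assoc', div_le_div_iff₀ (by positivity) (by positivity)]
    nlinarith
  have h2 : η * Fintype.card (CertificateStructure.Arc n) ≤ ε / 2 := by
    rw [hηdef, div_mul_eq_mul_div, div_le_div_iff₀ (by positivity) (by positivity)]
    nlinarith
  set X := ∑ M ∈ C.elements, α ∅ M ^ 2 + ε with hX
  have hXpos : 0 < X := add_pos_of_nonneg_of_pos (Finset.sum_nonneg fun _ _ => sq_nonneg _) hε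
  have hs : 0 < √X := Real.sqrt_pos.2 hXpos
  have hw' : ∀ e, 0 < w e / √X := fun e => div_pos (hw e) hs
  unfold learningGraphComplexity
  refine iInf_le_of_le (hypercubeLearningGraph n _ hw') (iInf_le_of_le p (iInf_le_of_le ?_ ?_))
  · exact fun M hM => ⟨(hp M hM).1.1, (hp M hM).1.2⟩
  · refine ENNReal.ofReal_le_ofReal (max_le ?_ (Real.iSup_le (fun M => ?_) hs.le))
    · have : (hypercubeLearningGraph n _ hw').negativeComplexity =
          (hypercubeLearningGraph n w hw).negativeComplexity / √X :=
        (Finset.sum_div _ _ _).symm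
      rw [this, div_le_iff₀ hs, Real.mul_self_sqrt hXpos.le]
      linarith
    · have : (hypercubeLearningGraph n _ hw').positiveComplexity (p M) =
          √X * (hypercubeLearningGraph n w hw).positiveComplexity (p M) := by
        unfold LearningGraph.positiveComplexity
        rw [Finset.mul_sum]
        refine Finset.sum_congr rfl fun e _ => ?_
        change p M e ^ 2 / (w e / √X) = √X * (p M e ^ 2 / w e)
        rw [div_div_eq_mul_div]; ring
      rw [this]
      exact mul_le_of_le_one_right hs.le (hp M M.2).2

/-! ### The adversary method -/

/-- The real part of the standard inner product of two complex vectors. -/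
def reDot {κ : Type*} [Fintype κ] (a b : κ → ℂ) : ℝ :=
  ∑ k, ((a k).re * (b k).re + (a k).im * (b k).im)

theorem reDot_self {κ : Type*} [Fintype κ] (a : κ → ℂ) : reDot a a = ∑ k, ‖a k‖ ^ 2 := by
  unfold reDot
  refine Finset.sum_congr rfl fun k _ => ?_
  rw [Complex.sq_norm, Complex.normSq_apply]

theorem reDot_eq_re_dotProduct {κ : Type*} [Fintype κ] (a b : κ → ℂ) :
    reDot a b = (star a ⬝ᵥ b).re := by
  simp [reDot, dotProduct]

theorem reDot_unitary_mulVec {κ : Type*} [Fintype κ] [DecidableEq κ]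
    (U : Matrix.unitaryGroup κ ℂ) (a b : κ → ℂ) :
    reDot (U.1.mulVec a) (U.1.mulVec b) = reDot a b := by
  rw [reDot_eq_re_dotProduct, reDot_eq_re_dotProduct, Matrix.star_mulVec,
    ← Matrix.dotProduct_mulVec, Matrix.mulVec_mulVec, ← Matrix.star_eq_conjTranspose,
    Matrix.UnitaryGroup.star_mul_self, Matrix.one_mulVec]

theorem reDot_eq_sum_index {n q w : ℕ} (ψ φ : QueryBasis n q w → ℂ) :
    reDot ψ φ = ∑ j, reDot (fun k => ψ (j, k)) (fun k => φ (j, k)) :=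
  Fintype.sum_prod_type _

/-- `K` bounds the norm of the bilinear form of the real matrix `Γ`.  The bound is stated with the
arithmetic mean of the squared norms, which makes it additive over the coordinates of vectors. -/
def IsFormBound {R Y : Type*} [Fintype R] [Fintype Y] (Γ : R → Y → ℝ) (K : ℝ) : Prop :=
  ∀ (a : R → ℝ) (b : Y → ℝ),
    ∑ r, ∑ s, Γ r s * (a r * b s) ≤ K / 2 * (∑ r, a r ^ 2 + ∑ s, b s ^ 2)

section FormBound

variable {R Y κ : Type*} [Fintype R] [Fintype Y] [Fintype κ] {Γ : R → Y → ℝ} {K : ℝ}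

theorem IsFormBound.reDot_le (h : IsFormBound Γ K) (a : R → κ → ℂ) (b : Y → κ → ℂ) :
    ∑ r, ∑ s, Γ r s * reDot (a r) (b s) ≤
      K / 2 * (∑ r, ∑ k, ‖a r k‖ ^ 2 + ∑ s, ∑ k, ‖b s k‖ ^ 2) := by
  have h1 : ∑ r, ∑ s, Γ r s * reDot (a r) (b s) =
      ∑ k, (∑ r, ∑ s, Γ r s * ((a r k).re * (b s k).re) +
        ∑ r, ∑ s, Γ r s * ((a r k).im * (b s k).im)) := by
    simp only [reDot, Finset.mul_sum, ← Finset.sum_add_distrib, ← mul_add]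
    rw [Finset.sum_comm' (t' := Finset.univ) (s' := fun _ => Finset.univ) (by simp)]
    conv_rhs => rw [Finset.sum_comm]
    rw [Finset.sum_comm]
    exact Finset.sum_congr rfl fun r _ => Finset.sum_comm
  have h2 : K / 2 * (∑ r, ∑ k, ‖a r k‖ ^ 2 + ∑ s, ∑ k, ‖b s k‖ ^ 2) =
      ∑ k, (K / 2 * (∑ r, (a r k).re ^ 2 + ∑ s, (b s k).re ^ 2) +
        K / 2 * (∑ r, (a r k).im ^ 2 + ∑ s, (b s k).im ^ 2)) := by
    simp only [Complex.sq_norm, Complex.normSq_apply, ← pow_two, ← mul_add, ← Finset.mul_sum]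
    rw [Finset.sum_comm, Finset.sum_comm (s := (Finset.univ : Finset Y)), ← Finset.sum_add_distrib]
    congr 1
    refine Finset.sum_congr rfl fun k _ => ?_
    simp only [Finset.sum_add_distrib]
    ring
  rw [h1, h2]
  exact Finset.sum_le_sum fun k _ => add_le_add (h _ _) (h _ _)

theorem IsFormBound.weighted_reDot_le (h : IsFormBound Γ K) (u : R → ℝ) (v : Y → ℝ)
    (a : R → κ → ℂ) (b : Y → κ → ℂ) :
    ∑ r, ∑ s, Γ r s * (u r * v s * reDot (a r) (b s)) ≤
      K / 2 * (∑ r, u r ^ 2 * ∑ k, ‖a r k‖ ^ 2 + ∑ s, v s ^ 2 * ∑ k, ‖b s k‖ ^ 2) := by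
  have := h.reDot_le (fun r k => (u r : ℂ) * a r k) (fun s k => (v s : ℂ) * b s k)
  simp only [norm_mul, mul_pow, Complex.norm_real, Real.norm_eq_abs, sq_abs, ← Finset.mul_sum] at this
  refine le_trans (le_of_eq ?_) this
  refine Finset.sum_congr rfl fun r _ => Finset.sum_congr rfl fun s _ => ?_
  congr 1
  unfold reDot
  rw [Finset.mul_sum]
  refine Finset.sum_congr rfl fun k _ => ?_
  simp only [Complex.re_ofReal_mul, Complex.im_ofReal_mul]
  ring

/-- The best bound of a bilinear form is attained. -/
theorem exists_attained_formBound (Γ : R → Y → ℝ) (a : R → ℝ) (b : Y → ℝ)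
    (hab : ∑ r, a r ^ 2 + ∑ s, b s ^ 2 ≤ 2) :
    ∃ (N : ℝ) (u : R → ℝ) (v : Y → ℝ), ∑ r, u r ^ 2 + ∑ s, v s ^ 2 ≤ 2 ∧ IsFormBound Γ N ∧
      N = ∑ r, ∑ s, Γ r s * (u r * v s) ∧ ∑ r, ∑ s, Γ r s * (a r * b s) ≤ N ∧ 0 ≤ N := by
  let S : Set ((R → ℝ) × (Y → ℝ)) := {p | ∑ r, p.1 r ^ 2 + ∑ s, p.2 s ^ 2 ≤ 2}
  have hS : IsCompact S := by
    refine Metric.isCompact_of_isClosed_isBounded (isClosed_le (by fun_prop) continuous_const) ?_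
    refine (Metric.isBounded_closedBall (x := (0 : (R → ℝ) × (Y → ℝ))) (r := 2)).subset ?_
    intro p hp
    have hp' : ∑ r, p.1 r ^ 2 + ∑ s, p.2 s ^ 2 ≤ 2 := hp
    rw [mem_closedBall_zero_iff, Prod.norm_def, max_le_iff, pi_norm_le_iff_of_nonneg two_pos.le,
      pi_norm_le_iff_of_nonneg two_pos.le]
    have h1 : 0 ≤ ∑ r, p.1 r ^ 2 := Finset.sum_nonneg fun _ _ => sq_nonneg _
    have h2 : 0 ≤ ∑ s, p.2 s ^ 2 := Finset.sum_nonneg fun _ _ => sq_nonneg _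
    refine ⟨fun r => ?_, fun s => ?_⟩
    · have := Finset.single_le_sum (f := fun r => p.1 r ^ 2) (fun _ _ => sq_nonneg _)
        (Finset.mem_univ r)
      exact abs_le_of_sq_le_sq (by linarith) two_pos.le
    · have := Finset.single_le_sum (f := fun r => p.2 r ^ 2) (fun _ _ => sq_nonneg _)
        (Finset.mem_univ s)
      exact abs_le_of_sq_le_sq (by linarith) two_pos.le
  obtain ⟨⟨u, v⟩, huv, hmax⟩ := hS.exists_isMaxOn ⟨(a, b), hab⟩
    (f := fun p => ∑ r, ∑ s, Γ r s * (p.1 r * p.2 s)) (Continuous.continuousOn (by fun_prop))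
  refine ⟨_, u, v, huv, ?_, rfl, hmax (show (a, b) ∈ S from hab), ?_⟩
  · intro x y
    set N := ∑ r, ∑ s, Γ r s * (u r * v s) with hN
    set X := ∑ r, x r ^ 2 + ∑ s, y s ^ 2 with hX
    have hx : 0 ≤ ∑ r, x r ^ 2 := Finset.sum_nonneg fun _ _ => sq_nonneg _
    have hy : 0 ≤ ∑ s, y s ^ 2 := Finset.sum_nonneg fun _ _ => sq_nonneg _
    rcases (add_nonneg hx hy).eq_or_lt with h0 | hpos
    · rw [← hX] at h0
      have hx0 : ∀ r, x r = 0 := by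
        have : ∑ r, x r ^ 2 = 0 := by linarith
        rw [Finset.sum_eq_zero_iff_of_nonneg fun _ _ => sq_nonneg _] at this
        exact fun r => by simpa using this r (Finset.mem_univ _)
      simp [hx0, ← h0]
    · set t := √(2 / X) with ht
      have ht2 : t ^ 2 = 2 / X := Real.sq_sqrt (div_nonneg two_pos.le hpos.le)
      have hmem : ((fun r => t * x r, fun s => t * y s) : (R → ℝ) × (Y → ℝ)) ∈ S := by
        change ∑ r, (t * x r) ^ 2 + ∑ s, (t * y s) ^ 2 ≤ 2
        simp only [mul_pow, ← Finset.mul_sum]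
        rw [← mul_add, ht2, ← hX, div_mul_cancel₀ _ hpos.ne']
      have h := hmax hmem
      have h' : ∑ r, ∑ s, Γ r s * (t * x r * (t * y s)) ≤ N := h
      have h2 : ∑ r, ∑ s, Γ r s * (t * x r * (t * y s)) =
          2 / X * ∑ r, ∑ s, Γ r s * (x r * y s) := by
        rw [← ht2]
        simp only [Finset.mul_sum]
        exact Finset.sum_congr rfl fun r _ => Finset.sum_congr rfl fun s _ => by ring
      rw [h2, div_mul_eq_mul_div, div_le_iff₀ hpos] at h'
      linarith
  · have h0 : ((0, 0) : (R → ℝ) × (Y → ℝ)) ∈ S := by simp [S]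
    simpa using hmax h0

end FormBound

namespace QuantumQueryAlgorithm

variable {n q T : ℕ} [NeZero q]

/-- The input of a query algorithm extended by `z_0 = 0`. -/
def extendInput (z : Fin n → Fin q) : Fin (n + 1) → Fin q := Fin.cons 0 z

/-- A query does not change the part of an inner product that queries a variable on which the two
inputs agree. -/
theorem reDot_applyOracle {w : ℕ} (x y : Fin n → Fin q) (ψ φ : QueryBasis n q w → ℂ)
    (j : Fin (n + 1)) (h : extendInput x j = extendInput y j) :
    reDot (fun k => applyOracle x ψ (j, k)) (fun k => applyOracle y φ (j, k)) =
      reDot (fun k => ψ (j, k)) (fun k => φ (j, k)) := by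
  unfold reDot applyOracle
  simp only
  change ∑ k : Fin q × Fin (w + 1) × Bool,
    ((ψ (j, k.1 - extendInput x j, k.2)).re * (φ (j, k.1 - extendInput y j, k.2)).re +
      (ψ (j, k.1 - extendInput x j, k.2)).im * (φ (j, k.1 - extendInput y j, k.2)).im) = _
  rw [← h]
  exact Fintype.sum_equiv ((Equiv.subRight (extendInput x j)).prodCongr (Equiv.refl _)) _ _
    fun k => rfl

theorem sum_norm_sq_applyOracle {w : ℕ} (x : Fin n → Fin q) (ψ : QueryBasis n q w → ℂ)
    (j : Fin (n + 1)) :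
    ∑ k, ‖applyOracle x ψ (j, k)‖ ^ 2 = ∑ k, ‖ψ (j, k)‖ ^ 2 := by
  have := reDot_applyOracle x x ψ ψ j rfl
  rwa [reDot_self, reDot_self] at this

theorem state_succ (𝒜 : QuantumQueryAlgorithm n q T) (z : Fin n → Fin q) (t : Fin T) :
    𝒜.state z t.succ = (𝒜.U t.succ).1.mulVec (applyOracle z (𝒜.state z t.castSucc)) := by
  simp only [state, Fin.induction_succ]

theorem reDot_state_zero (𝒜 : QuantumQueryAlgorithm n q T) (x y : Fin n → Fin q) :
    reDot (𝒜.state x 0) (𝒜.state y 0) = 1 := by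
  simp only [state, Fin.induction_zero]
  rw [reDot_unitary_mulVec, reDot_self, Finset.sum_eq_single (0, 0, 0, false)]
  · simp [initialState]
  · intro b _ hb
    simp [initialState, Pi.single_eq_of_ne hb]
  · simp

theorem sum_norm_sq_state (𝒜 : QuantumQueryAlgorithm n q T) (z : Fin n → Fin q) (t : Fin (T + 1)) :
    ∑ k, ‖𝒜.state z t k‖ ^ 2 = 1 := by
  induction t using Fin.induction with
  | zero => rw [← reDot_self, reDot_state_zero]
  | succ t ih =>
    rw [← ih, ← reDot_self, state_succ, reDot_unitary_mulVec, reDot_eq_sum_index,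
      Fintype.sum_prod_type]
    exact Finset.sum_congr rfl fun j _ => by rw [reDot_self, sum_norm_sq_applyOracle]

variable {R Y : Type*} [Fintype R] [Fintype Y]

/-- The progress function of the adversary method at time `t`. -/
def progress (𝒜 : QuantumQueryAlgorithm n q T) (x : R → Fin n → Fin q) (y : Y → Fin n → Fin q)
    (Γ : R → Y → ℝ) (u : R → ℝ) (v : Y → ℝ) (t : Fin (T + 1)) : ℝ :=
  ∑ r, ∑ s, Γ r s * (u r * v s * reDot (𝒜.state (x r) t) (𝒜.state (y s) t))

/-- One query changes the progress function by at most `2K`.  The part of the state that queries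
`x_j` sees only the entries of `Γ` with `x_j ≠ y_j`, where `Γ` can be replaced by `Γ_j`. -/
theorem progress_sub_progress_succ_le (𝒜 : QuantumQueryAlgorithm n q T) (x : R → Fin n → Fin q)
    (y : Y → Fin n → Fin q) (Γ : R → Y → ℝ) (Γ' : Fin n → R → Y → ℝ) {K : ℝ} (hK : 0 ≤ K)
    (hΓ : ∀ j r s, x r j ≠ y s j → Γ' j r s = Γ r s) (hΓ' : ∀ j, IsFormBound (Γ' j) K)
    (u : R → ℝ) (v : Y → ℝ) (huv : ∑ r, u r ^ 2 + ∑ s, v s ^ 2 ≤ 2) (t : Fin T) :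
    𝒜.progress x y Γ u v t.castSucc - 𝒜.progress x y Γ u v t.succ ≤ 2 * K := by
  set ψ := fun z => 𝒜.state z t.castSucc with hψ
  set m : (Fin n → Fin q) → Fin (n + 1) → ℝ := fun z j => ∑ k, ‖ψ z (j, k)‖ ^ 2 with hm
  have hm1 : ∀ z, ∑ j : Fin n, m z j.succ ≤ 1 := by
    intro z
    have h := 𝒜.sum_norm_sq_state z t.castSucc
    rw [Fintype.sum_prod_type, Fin.sum_univ_succ] at h
    have h0 : 0 ≤ m z 0 := Finset.sum_nonneg fun _ _ => sq_nonneg _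
    change m z 0 + ∑ j : Fin n, m z j.succ = 1 at h
    linarith
  set P : R → Y → Fin (n + 1) → ℝ := fun r s j =>
    reDot (fun k => ψ (x r) (j, k)) (fun k => ψ (y s) (j, k)) with hP
  set P' : R → Y → Fin (n + 1) → ℝ := fun r s j =>
    reDot (fun k => applyOracle (x r) (ψ (x r)) (j, k))
      (fun k => applyOracle (y s) (ψ (y s)) (j, k)) with hP'
  have hterm : ∀ r s, Γ r s * (u r * v s * reDot (𝒜.state (x r) t.castSucc) (𝒜.state (y s) t.castSucc)) -
      Γ r s * (u r * v s * reDot (𝒜.state (x r) t.succ) (𝒜.state (y s) t.succ)) =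
      ∑ j : Fin n, (Γ' j r s * (u r * v s * P r s j.succ) +
        Γ' j r s * (-u r * v s * P' r s j.succ)) := by
    intro r s
    rw [state_succ, state_succ, reDot_unitary_mulVec, reDot_eq_sum_index, reDot_eq_sum_index]
    change Γ r s * (u r * v s * ∑ j, P r s j) - Γ r s * (u r * v s * ∑ j, P' r s j) = _
    have h0 : P' r s 0 = P r s 0 := reDot_applyOracle _ _ _ _ _ rfl
    rw [Fin.sum_univ_succ, Fin.sum_univ_succ, h0, ← mul_sub, ← mul_sub, add_sub_add_left_eq_sub,
      ← Finset.sum_sub_distrib, Finset.mul_sum, Finset.mul_sum]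
    refine Finset.sum_congr rfl fun j _ => ?_
    by_cases h : x r j = y s j
    · have : P' r s j.succ = P r s j.succ := reDot_applyOracle _ _ _ _ _ (by simpa [extendInput])
      rw [this]; ring
    · rw [hΓ j r s h]; ring
  have hdiff : 𝒜.progress x y Γ u v t.castSucc - 𝒜.progress x y Γ u v t.succ =
      ∑ j : Fin n, (∑ r, ∑ s, Γ' j r s * (u r * v s * P r s j.succ) +
        ∑ r, ∑ s, Γ' j r s * (-u r * v s * P' r s j.succ)) := by
    unfold progress
    simp only [← Finset.sum_sub_distrib, hterm, ← Finset.sum_add_distrib]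
    rw [Finset.sum_comm' (t' := Finset.univ) (s' := fun _ => Finset.univ) (by simp)]
    conv_rhs => rw [Finset.sum_comm]
    rw [Finset.sum_comm]
    exact Finset.sum_congr rfl fun r _ => Finset.sum_comm
  have hj : ∀ j : Fin n, ∑ r, ∑ s, Γ' j r s * (u r * v s * P r s j.succ) +
        ∑ r, ∑ s, Γ' j r s * (-u r * v s * P' r s j.succ) ≤
      K * (∑ r, u r ^ 2 * m (x r) j.succ + ∑ s, v s ^ 2 * m (y s) j.succ) := by
    intro j
    have h1 := (hΓ' j).weighted_reDot_le u v (fun r k => ψ (x r) (j.succ, k))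
      (fun s k => ψ (y s) (j.succ, k))
    have h2 := (hΓ' j).weighted_reDot_le (fun r => -u r) v
      (fun r k => applyOracle (x r) (ψ (x r)) (j.succ, k))
      (fun s k => applyOracle (y s) (ψ (y s)) (j.succ, k))
    simp only [sum_norm_sq_applyOracle, neg_sq] at h2
    refine (add_le_add h1 h2).trans (le_of_eq ?_)
    simp only [hm]
    ring
  rw [hdiff]
  refine (Finset.sum_le_sum fun j _ => hj j).trans ?_
  rw [← Finset.mul_sum, Finset.sum_add_distrib, Finset.sum_comm,
    Finset.sum_comm (t := (Finset.univ : Finset Y))]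
  simp only [← Finset.mul_sum]
  have h1 : ∑ r, u r ^ 2 * ∑ j : Fin n, m (x r) j.succ ≤ ∑ r, u r ^ 2 :=
    Finset.sum_le_sum fun r _ => mul_le_of_le_one_right (sq_nonneg _) (hm1 _)
  have h2 : ∑ s, v s ^ 2 * ∑ j : Fin n, m (y s) j.succ ≤ ∑ s, v s ^ 2 :=
    Finset.sum_le_sum fun r _ => mul_le_of_le_one_right (sq_nonneg _) (hm1 _)
  nlinarith

/-- At the end of a bounded-error algorithm, the states of inputs with different values are so far
from parallel that the progress is below the bound of the form by a constant factor.  The factors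
`4/5` and `5/4` balance the masses on the wrong and the right output. -/
theorem progress_last_le (𝒜 : QuantumQueryAlgorithm n q T) (x : R → Fin n → Fin q)
    (y : Y → Fin n → Fin q) (Γ : R → Y → ℝ) {f : (Fin n → Fin q) → Bool} (hf : 𝒜.Evaluates f)
    (hx : ∀ r, f (x r) = true) (hy : ∀ s, f (y s) = false) {N : ℝ} (hN0 : 0 ≤ N)
    (hN : IsFormBound Γ N) (u : R → ℝ) (v : Y → ℝ) (huv : ∑ r, u r ^ 2 + ∑ s, v s ^ 2 ≤ 2) :
    𝒜.progress x y Γ u v (Fin.last T) ≤ 379 / 400 * N := by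
  let ψ : (Fin n → Fin q) → Bool → (Fin (n + 1) × Fin q × Fin (𝒜.workDim + 1)) → ℂ :=
    fun z b k => 𝒜.state z (Fin.last T) (k.1, k.2.1, k.2.2, b)
  have hsplit : ∀ F : QueryBasis n q 𝒜.workDim → ℝ, ∑ k, F k =
      ∑ k : Fin (n + 1) × Fin q × Fin (𝒜.workDim + 1), F (k.1, k.2.1, k.2.2, true) +
      ∑ k : Fin (n + 1) × Fin q × Fin (𝒜.workDim + 1), F (k.1, k.2.1, k.2.2, false) := by
    intro F
    rw [← Finset.sum_add_distrib]
    simp only [Fintype.sum_prod_type, Fintype.sum_bool]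
  have hout : ∀ z b, 𝒜.outputProbability z b = ∑ k, ‖ψ z b k‖ ^ 2 := by
    intro z b
    simp only [Fintype.sum_prod_type, ψ, outputProbability]
  have hsum : ∀ z, 𝒜.outputProbability z true + 𝒜.outputProbability z false = 1 := by
    intro z
    rw [hout, hout, ← 𝒜.sum_norm_sq_state z (Fin.last T)]
    exact (hsplit fun k => ‖𝒜.state z (Fin.last T) k‖ ^ 2).symm
  have hdot : ∀ r s, reDot (𝒜.state (x r) (Fin.last T)) (𝒜.state (y s) (Fin.last T)) =
      reDot (ψ (x r) true) (ψ (y s) true) + reDot (ψ (x r) false) (ψ (y s) false) :=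
    fun r s => hsplit _
  have hprog : 𝒜.progress x y Γ u v (Fin.last T) =
      ∑ r, ∑ s, Γ r s * ((4 / 5 * u r) * (5 / 4 * v s) * reDot (ψ (x r) true) (ψ (y s) true)) +
      ∑ r, ∑ s, Γ r s * ((5 / 4 * u r) * (4 / 5 * v s) * reDot (ψ (x r) false) (ψ (y s) false)) := by
    unfold progress
    simp only [hdot, ← Finset.sum_add_distrib]
    exact Finset.sum_congr rfl fun r _ => Finset.sum_congr rfl fun s _ => by ring
  have h1 := hN.weighted_reDot_le (fun r => 4 / 5 * u r) (fun s => 5 / 4 * v s)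
    (fun r => ψ (x r) true) (fun s => ψ (y s) true)
  have h2 := hN.weighted_reDot_le (fun r => 5 / 4 * u r) (fun s => 4 / 5 * v s)
    (fun r => ψ (x r) false) (fun s => ψ (y s) false)
  simp only [← hout] at h1 h2
  have h3 : ∑ r, (4 / 5 * u r) ^ 2 * 𝒜.outputProbability (x r) true +
      ∑ r, (5 / 4 * u r) ^ 2 * 𝒜.outputProbability (x r) false ≤ 379 / 400 * ∑ r, u r ^ 2 := by
    rw [← Finset.sum_add_distrib, Finset.mul_sum]
    refine Finset.sum_le_sum fun r _ => ?_
    have ha := hsum (x r)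
    have hb := hf (x r)
    rw [hx] at hb
    nlinarith [mul_nonneg (sq_nonneg (u r)) (sub_nonneg.2 hb)]
  have h4 : ∑ s, (5 / 4 * v s) ^ 2 * 𝒜.outputProbability (y s) true +
      ∑ s, (4 / 5 * v s) ^ 2 * 𝒜.outputProbability (y s) false ≤ 379 / 400 * ∑ s, v s ^ 2 := by
    rw [← Finset.sum_add_distrib, Finset.mul_sum]
    refine Finset.sum_le_sum fun r _ => ?_
    have ha := hsum (y r)
    have hb := hf (y r)
    rw [hy] at hb
    nlinarith [mul_nonneg (sq_nonneg (v r)) (sub_nonneg.2 hb)]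
  rw [hprog]
  nlinarith [mul_le_mul_of_nonneg_left (add_le_add h3 h4) hN0, mul_le_mul_of_nonneg_left huv hN0]

/-- The negative-weight adversary bound, for a matrix whose rows may repeat inputs.  The progress is
measured along vectors `u`, `v` attaining the norm `N` of `Γ` rather than along `a`, `b`: it starts
at `N`, and it ends below a constant multiple of `N` that is less than `1`. -/
theorem adversary_bound (𝒜 : QuantumQueryAlgorithm n q T) (x : R → Fin n → Fin q)
    (y : Y → Fin n → Fin q) {f : (Fin n → Fin q) → Bool} (hf : 𝒜.Evaluates f)
    (hx : ∀ r, f (x r) = true) (hy : ∀ s, f (y s) = false)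
    (Γ : R → Y → ℝ) (Γ' : Fin n → R → Y → ℝ) {K : ℝ} (hK : 0 ≤ K)
    (hΓ : ∀ j r s, x r j ≠ y s j → Γ' j r s = Γ r s) (hΓ' : ∀ j, IsFormBound (Γ' j) K)
    (a : R → ℝ) (b : Y → ℝ) (hab : ∑ r, a r ^ 2 + ∑ s, b s ^ 2 ≤ 2) :
    ∑ r, ∑ s, Γ r s * (a r * b s) ≤ 40 * K * T := by
  obtain ⟨N, u, v, huv, hN, hNuv, hle, hN0⟩ := exists_attained_formBound Γ a b hab
  have hzero : 𝒜.progress x y Γ u v 0 = N := by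
    simp only [progress, reDot_state_zero, mul_one, hNuv]
  have hstep : ∀ t : Fin (T + 1), N - 2 * K * (t : ℕ) ≤ 𝒜.progress x y Γ u v t := by
    intro t
    induction t using Fin.induction with
    | zero => simp [hzero]
    | succ t ih =>
      have := 𝒜.progress_sub_progress_succ_le x y Γ Γ' hK hΓ hΓ' u v huv t
      simp only [Fin.val_succ, Fin.val_castSucc] at ih ⊢
      push_cast
      linarith
  have h1 := hstep (Fin.last T)
  have h2 := 𝒜.progress_last_le x y Γ hf hx hy hN0 hN u v huv
  simp only [Fin.val_last] at h1
  have h3 : 0 ≤ K * T := mul_nonneg hK (Nat.cast_nonneg T)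
  nlinarith

end QuantumQueryAlgorithm

/-! ### Mean-zero projections and orthogonal arrays -/

section Kernels

variable {ι : Type} [Fintype ι] [DecidableEq ι] {q : ℕ} [NeZero q]

/-- The kernel on `[q]` of the projection onto the functions with zero mean (`b` true), or onto the
constant functions (`b` false). -/
noncomputable def meanKernel (b : Prop) [Decidable b] (s t : Fin q) : ℝ :=
  if b then (if s = t then 1 else 0) - 1 / q else 1 / q

/-- The kernel on `[q]^ι` of the orthogonal projection onto the functions that are constant in the
coordinates outside `S` and have zero mean in each coordinate of `S`. -/
noncomputable def projKernel (S : Finset ι) (x y : ι → Fin q) : ℝ :=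
  ∏ j, meanKernel (j ∈ S) (x j) (y j)

theorem sum_meanKernel (b : Prop) [Decidable b] (t : Fin q) :
    ∑ s, meanKernel b s t = if b then 0 else 1 := by
  have hq : (q : ℝ) ≠ 0 := Nat.cast_ne_zero.2 (NeZero.ne q)
  unfold meanKernel
  split_ifs <;> simp [hq]

theorem sum_meanKernel_mul (b c : Prop) [Decidable b] [Decidable c] (s t : Fin q) :
    ∑ a, meanKernel b a s * meanKernel c a t = if (b ↔ c) then meanKernel b s t else 0 := by
  have hq : (q : ℝ) ≠ 0 := Nat.cast_ne_zero.2 (NeZero.ne q)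
  have h1 : ∑ a : Fin q, ((if a = s then (1 : ℝ) else 0) - 1 / q) = 0 := by simp [hq]
  have h2 : ∑ a : Fin q, ((if a = t then (1 : ℝ) else 0) - 1 / q) = 0 := by simp [hq]
  by_cases hb : b <;> by_cases hc : c <;>
    simp only [meanKernel, hb, hc, if_true, if_false, iff_self, iff_false, iff_true, not_true_eq_false]
  · simp only [mul_sub]
    rw [Finset.sum_sub_distrib, ← Finset.sum_mul, h1, zero_mul, sub_zero]
    simp [eq_comm]
  · rw [← Finset.sum_mul, h1, zero_mul]
  · rw [← Finset.mul_sum, h2, mul_zero]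
  · simp [hq]

omit [NeZero q] in
theorem sum_prod_eq_prod_sum (F : ι → Fin q → ℝ) :
    ∑ x : ι → Fin q, ∏ j, F j (x j) = ∏ j, ∑ a, F j a := by
  rw [Finset.prod_univ_sum, Fintype.piFinset_univ]

theorem sum_projKernel (S : Finset ι) (y : ι → Fin q) :
    ∑ x, projKernel S x y = if S = ∅ then 1 else 0 := by
  unfold projKernel
  rw [sum_prod_eq_prod_sum fun j a => meanKernel (j ∈ S) a (y j)]
  simp only [sum_meanKernel]
  split_ifs with h
  · simp [h]
  · obtain ⟨j, hj⟩ := Finset.nonempty_iff_ne_empty.2 h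
    exact Finset.prod_eq_zero (Finset.mem_univ j) (if_pos hj)

/-- The projections for different `S` are orthogonal. -/
theorem sum_projKernel_mul (S T : Finset ι) (y z : ι → Fin q) :
    ∑ x, projKernel S x y * projKernel T x z = if S = T then projKernel S y z else 0 := by
  unfold projKernel
  simp only [← Finset.prod_mul_distrib]
  rw [sum_prod_eq_prod_sum fun j a => meanKernel (j ∈ S) a (y j) * meanKernel (j ∈ T) a (z j)]
  simp only [sum_meanKernel_mul]
  split_ifs with h
  · simp [h]
  · have : ∃ j, ¬ (j ∈ S ↔ j ∈ T) := by
      by_contra! hall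
      exact h (Finset.ext hall)
    obtain ⟨j, hj⟩ := this
    exact Finset.prod_eq_zero (Finset.mem_univ j) (if_neg hj)

omit [NeZero q] in
/-- The projections for all `S` sum up to the identity. -/
theorem sum_projKernel_univ (x y : ι → Fin q) : ∑ S, projKernel S x y = if x = y then 1 else 0 := by
  have h := Finset.prod_add (fun j => meanKernel True (x j) (y j))
    (fun j => meanKernel False (x j) (y j)) (Finset.univ : Finset ι)
  rw [Finset.powerset_univ] at h
  have h2 : ∀ S : Finset ι, projKernel S x y = (∏ j ∈ S, meanKernel True (x j) (y j)) *
      ∏ j ∈ Finset.univ \ S, meanKernel False (x j) (y j) := by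
    intro S
    unfold projKernel
    rw [← Finset.prod_sdiff (Finset.subset_univ S), mul_comm]
    congr 1
    · exact Finset.prod_congr rfl fun j hj => by simp [meanKernel, hj]
    · exact Finset.prod_congr rfl fun j hj => by simp [meanKernel, (Finset.mem_sdiff.1 hj).2]
  simp only [h2, ← h]
  simp only [meanKernel, if_true, if_false, sub_add_cancel]
  split_ifs with hxy
  · simp [hxy]
  · obtain ⟨j, hj⟩ := Function.ne_iff.1 hxy
    exact Finset.prod_eq_zero (Finset.mem_univ j) (if_neg hj)

omit [NeZero q] in
/-- Off the diagonal in coordinate `j`, moving `j` into `S` only changes the sign. -/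
theorem projKernel_insert {S : Finset ι} {j : ι} (hj : j ∉ S) {x y : ι → Fin q} (h : x j ≠ y j) :
    projKernel (insert j S) x y = - projKernel S x y := by
  unfold projKernel
  rw [← Finset.mul_prod_erase _ _ (Finset.mem_univ j), ← Finset.mul_prod_erase _ _ (Finset.mem_univ j),
    ← neg_mul]
  congr 1
  · simp [meanKernel, hj, h]
  · refine Finset.prod_congr rfl fun i hi => ?_
    simp [meanKernel, Finset.mem_insert, Finset.ne_of_mem_erase hi]

omit [NeZero q] in
theorem projKernel_update {S : Finset ι} {i : ι} (hi : i ∉ S) (x y : ι → Fin q) (a : Fin q) :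
    projKernel S (Function.update x i a) y = projKernel S x y := by
  refine Finset.prod_congr rfl fun j _ => ?_
  by_cases h : j = i
  · subst h; simp [meanKernel, hi]
  · rw [Function.update_of_ne h]

/-- The value at `x` of the projection of `v`. -/
noncomputable def proj (S : Finset ι) (v : (ι → Fin q) → ℝ) (x : ι → Fin q) : ℝ :=
  ∑ y, projKernel S x y * v y

/-- The squared norm of the projection of `v`. -/
noncomputable def projNormSq (S : Finset ι) (v : (ι → Fin q) → ℝ) : ℝ :=
  ∑ x, proj S v x ^ 2

omit [NeZero q] in
theorem projNormSq_nonneg (S : Finset ι) (v : (ι → Fin q) → ℝ) : 0 ≤ projNormSq S v :=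
  Finset.sum_nonneg fun _ _ => sq_nonneg _

theorem sum_proj_mul_proj (S T : Finset ι) (v : (ι → Fin q) → ℝ) :
    ∑ x, proj S v x * proj T v x = if S = T then ∑ y, v y * proj S v y else 0 := by
  have h : ∑ x, proj S v x * proj T v x =
      ∑ y, ∑ z, v y * v z * ∑ x, projKernel S x y * projKernel T x z := by
    simp only [proj, Finset.sum_mul_sum]
    simp only [Finset.mul_sum]
    rw [Finset.sum_comm]
    refine Finset.sum_congr rfl fun y _ => ?_
    rw [Finset.sum_comm]
    exact Finset.sum_congr rfl fun z _ => Finset.sum_congr rfl fun x _ => by ring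
  rw [h]
  simp only [sum_projKernel_mul]
  split_ifs with hST
  · simp only [proj, Finset.mul_sum]
    exact Finset.sum_congr rfl fun y _ => Finset.sum_congr rfl fun z _ => by ring
  · simp

/-- Pythagoras' theorem for the orthogonal projections. -/
theorem sum_sq_sum_proj (β : Finset ι → ℝ) (v : (ι → Fin q) → ℝ) :
    ∑ x, (∑ S, β S * proj S v x) ^ 2 = ∑ S, β S ^ 2 * projNormSq S v := by
  have h : ∑ x, (∑ S, β S * proj S v x) ^ 2 =
      ∑ S, ∑ T, β S * β T * ∑ x, proj S v x * proj T v x := by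
    simp only [pow_two, Finset.sum_mul_sum]
    simp only [Finset.mul_sum]
    rw [Finset.sum_comm]
    refine Finset.sum_congr rfl fun y _ => ?_
    rw [Finset.sum_comm]
    exact Finset.sum_congr rfl fun z _ => Finset.sum_congr rfl fun x _ => by ring
  rw [h]
  refine Finset.sum_congr rfl fun S _ => ?_
  rw [Finset.sum_eq_single S]
  · simp only [projNormSq, pow_two]
  · intro T _ hT
    rw [sum_proj_mul_proj, if_neg hT.symm, mul_zero]
  · simp

theorem sum_projNormSq (v : (ι → Fin q) → ℝ) : ∑ S, projNormSq S v = ∑ x, v x ^ 2 := by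
  have h : ∀ S, projNormSq S v = ∑ y, v y * proj S v y := by
    intro S
    simp only [projNormSq, pow_two]
    rw [sum_proj_mul_proj, if_pos rfl]
  simp only [h]
  rw [Finset.sum_comm]
  refine Finset.sum_congr rfl fun y _ => ?_
  rw [← Finset.mul_sum, pow_two]
  congr 1
  simp only [proj]
  rw [Finset.sum_comm]
  simp only [← Finset.sum_mul, sum_projKernel_univ]
  simp

/-- For every choice of the entries of `x` other than `x_i`, exactly one value of `x_i` gives an
element of `X`. -/
def IsUniqueAt (X : Finset (ι → Fin q)) (i : ι) : Prop :=
  ∀ x : ι → Fin q, (Finset.univ.filter fun a : Fin q => Function.update x i a ∈ X).card = 1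

omit [NeZero q] in
/-- The map `(x, a) ↦ (x with entry i set to a, x_i)` is an involution. -/
theorem sum_sum_update (i : ι) (G : (ι → Fin q) → ℝ) :
    ∑ x, ∑ a, G (Function.update x i a) = q * ∑ x, G x := by
  have hinv : Function.Involutive fun p : (ι → Fin q) × Fin q =>
      (Function.update p.1 i p.2, p.1 i) := by
    rintro ⟨x, a⟩
    simp
  have h := Equiv.sum_comp hinv.toPerm fun p : (ι → Fin q) × Fin q => G p.1
  rw [Fintype.sum_prod_type, Fintype.sum_prod_type] at h
  refine h.trans ?_
  simp [Finset.mul_sum]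

omit [NeZero q] in
/-- The average over `X` of a function that does not depend on the entry `x_i` is its average over
the whole space. -/
theorem IsUniqueAt.mul_sum {X : Finset (ι → Fin q)} {i : ι} (hX : IsUniqueAt X i)
    (F : (ι → Fin q) → ℝ) (hF : ∀ x a, F (Function.update x i a) = F x) :
    q * ∑ x ∈ X, F x = ∑ x, F x := by
  have h := sum_sum_update i fun x => if x ∈ X then F x else 0
  rw [← Finset.sum_filter, Finset.filter_mem_eq_inter, Finset.univ_inter] at h
  rw [← h]
  refine Finset.sum_congr rfl fun x _ => ?_
  simp only [hF]
  rw [← Finset.sum_filter, Finset.sum_const, hX x, one_smul]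

omit [NeZero q] in
theorem IsUniqueAt.mul_card {X : Finset (ι → Fin q)} {i : ι} (hX : IsUniqueAt X i) :
    (q : ℝ) * X.card = (q : ℝ) ^ Fintype.card ι := by
  have := hX.mul_sum (fun _ => 1) (fun _ _ => rfl)
  simpa using this

theorem sum_projKernel_of_isUniqueAt {X : Finset (ι → Fin q)} {i : ι} (hX : IsUniqueAt X i)
    {S : Finset ι} (hi : i ∉ S) (y : ι → Fin q) :
    q * ∑ x ∈ X, projKernel S x y = if S = ∅ then 1 else 0 := by
  rw [hX.mul_sum _ fun x a => projKernel_update hi x y a, sum_projKernel]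

/-- An operator `∑ β_S E_S` that involves no `S ⊇ A` is a sum of `|A|` operators, each of which
ignores one entry indexed by `A`.  On the output of such an operator, restricting to `X` and scaling
by `√q` is isometric. -/
theorem mul_sum_sq_sum_proj_le {A : Finset ι} {X : Finset (ι → Fin q)}
    (hX : ∀ i ∈ A, IsUniqueAt X i) {β : Finset ι → ℝ} (hβ : ∀ S, A ⊆ S → β S = 0)
    (v : (ι → Fin q) → ℝ) :
    q * ∑ x ∈ X, (∑ S, β S * proj S v x) ^ 2 ≤ A.card * ∑ S, β S ^ 2 * projNormSq S v := by
  -- Each `S` with `β S ≠ 0` is assigned to one `i ∈ A` outside `S`; the operator for `i` collects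
  -- the terms assigned to `i`.  `Option` covers an empty `ι`.
  have hex : ∀ S : Finset ι, ∃ i : Option ι, β S ≠ 0 → ∃ j ∈ A, j ∉ S ∧ i = some j := by
    intro S
    by_cases h : β S = 0
    · exact ⟨none, fun h' => absurd h h'⟩
    · obtain ⟨j, hjA, hjS⟩ := Finset.not_subset.1 fun hA => h (hβ S hA)
      exact ⟨some j, fun _ => ⟨j, hjA, hjS, rfl⟩⟩
  choose c hc using hex
  let γ : ι → Finset ι → ℝ := fun i S => if c S = some i then β S else 0
  have hγ : ∀ i S, i ∈ S → γ i S = 0 := by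
    intro i S hi
    by_contra hne
    have h1 : c S = some i := by
      by_contra h
      exact hne (if_neg h)
    have h2 : β S ≠ 0 := by simpa [γ, h1] using hne
    obtain ⟨j, -, hjS, hcj⟩ := hc S h2
    rw [h1, Option.some_inj] at hcj
    exact hjS (hcj ▸ hi)
  have hsum : ∀ (S : Finset ι) (φ : ℝ → ℝ), φ 0 = 0 → ∑ i ∈ A, φ (γ i S) = φ (β S) := by
    intro S φ hφ
    by_cases h : β S = 0
    · simp [γ, h, hφ]
    · obtain ⟨j, hjA, -, hcj⟩ := hc S h
      rw [Finset.sum_eq_single_of_mem j hjA]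
      · simp [γ, hcj]
      · intro i _ hij
        have : γ i S = 0 := if_neg (by rw [hcj, Option.some_inj]; exact hij.symm)
        rw [this, hφ]
  have hdecomp : ∀ x, ∑ S, β S * proj S v x = ∑ i ∈ A, ∑ S, γ i S * proj S v x := by
    intro x
    rw [Finset.sum_comm]
    refine Finset.sum_congr rfl fun S _ => ?_
    rw [← Finset.sum_mul, hsum S (fun t => t) rfl]
  have hpart : ∀ i ∈ A, q * ∑ x ∈ X, (∑ S, γ i S * proj S v x) ^ 2 =
      ∑ S, γ i S ^ 2 * projNormSq S v := by
    intro i hi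
    rw [(hX i hi).mul_sum, sum_sq_sum_proj]
    intro x a
    congr 1
    refine Finset.sum_congr rfl fun S _ => ?_
    by_cases hS : i ∈ S
    · rw [hγ i S hS, zero_mul, zero_mul]
    · simp only [proj, projKernel_update hS]
  calc (q : ℝ) * ∑ x ∈ X, (∑ S, β S * proj S v x) ^ 2
      ≤ q * ∑ x ∈ X, A.card * ∑ i ∈ A, (∑ S, γ i S * proj S v x) ^ 2 := by
        refine mul_le_mul_of_nonneg_left (Finset.sum_le_sum fun x _ => ?_) (Nat.cast_nonneg q)
        rw [hdecomp]
        exact sq_sum_le_card_mul_sum_sq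
    _ = A.card * ∑ i ∈ A, q * ∑ x ∈ X, (∑ S, γ i S * proj S v x) ^ 2 := by
        rw [← Finset.mul_sum, Finset.sum_comm, ← Finset.mul_sum]
        ring
    _ = A.card * ∑ S, β S ^ 2 * projNormSq S v := by
        rw [Finset.sum_congr rfl hpart, Finset.sum_comm]
        congr 1
        refine Finset.sum_congr rfl fun S _ => ?_
        rw [← Finset.sum_mul, hsum S (fun t => t ^ 2) (by norm_num)]

end Kernels

/-! ### The adversary matrix of a dual feasible point -/

theorem isFormBound_of_sum_sq_le {R Y : Type*} [Fintype R] [Fintype Y] {Γ : R → Y → ℝ} {K : ℝ}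
    (hK : 0 < K) (h : ∀ b : Y → ℝ, ∑ r, (∑ s, Γ r s * b s) ^ 2 ≤ K ^ 2 * ∑ s, b s ^ 2) :
    IsFormBound Γ K := by
  intro a b
  have h1 : ∀ r, ∑ s, Γ r s * (a r * b s) ≤
      K / 2 * a r ^ 2 + (∑ s, Γ r s * b s) ^ 2 / (2 * K) := by
    intro r
    have : ∑ s, Γ r s * (a r * b s) = a r * ∑ s, Γ r s * b s := by
      rw [Finset.mul_sum]
      exact Finset.sum_congr rfl fun s _ => by ring
    rw [this, ← sub_nonneg]
    have h2 : K / 2 * a r ^ 2 + (∑ s, Γ r s * b s) ^ 2 / (2 * K) - a r * ∑ s, Γ r s * b s =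
        (K * a r - ∑ s, Γ r s * b s) ^ 2 / (2 * K) := by
      field_simp
      ring
    rw [h2]
    positivity
  refine (Finset.sum_le_sum fun r _ => h1 r).trans ?_
  rw [Finset.sum_add_distrib, ← Finset.mul_sum, ← Finset.sum_div, mul_add]
  refine add_le_add le_rfl ?_
  rw [div_le_iff₀ (by positivity)]
  exact (h b).trans (le_of_eq (by ring))

section ArrayMatrix

variable {n q : ℕ} [NeZero q] (C : CertificateStructure n)
  (X : Finset (Finset (Fin n)) → Finset (Fin n → Fin q)) (f : (Fin n → Fin q) → Bool)

/-- The rows of the adversary matrix: an element `M` of the certificate structure and an input that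
satisfies the condition given by `M`. -/
abbrev AdversaryRow : Type :=
  Σ M : C.elements, {x : Fin n → Fin q // x ∈ X M}

/-- The columns of the adversary matrix: the negative inputs. -/
abbrev AdversaryColumn : Type :=
  {y : Fin n → Fin q // f y = false}

/-- The matrix with the blocks `√q ∑_S β_S(M) E_S`, where `E_S` is restricted to the rows in `X_M`
and to the negative inputs. -/
noncomputable def adversaryMatrix (β : Finset (Fin n) → Finset (Finset (Fin n)) → ℝ)
    (r : AdversaryRow C X) (s : AdversaryColumn f) : ℝ :=
  √q * ∑ S, β S r.1 * projKernel S r.2.1 s.1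

variable {C X}

omit [NeZero q] in
theorem sum_adversaryRow (F : Finset (Finset (Fin n)) → (Fin n → Fin q) → ℝ) :
    ∑ r : AdversaryRow C X, F r.1 r.2.1 = ∑ M ∈ C.elements, ∑ x ∈ X M, F M x := by
  rw [Fintype.sum_sigma, ← Finset.sum_coe_sort C.elements fun M => ∑ x ∈ X M, F M x]
  refine Finset.sum_congr rfl fun M _ => ?_
  exact Finset.sum_coe_sort (X M) (F M)

/-- By orthogonality of the `E_S`, coefficients with `∑_M β_S(M)² ≤ 1` for all `S` give an operator of
norm at most `1` before the rows are restricted.  Restricting them to the sets `X_M` and scaling by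
`√q` costs a factor of at most `√k`, for which `k + 1` is used as it is positive. -/
theorem isFormBound_adversaryMatrix {k : ℕ} {A : Finset (Finset (Fin n)) → Finset (Fin n)}
    (hk : ∀ M ∈ C.elements, (A M).card ≤ k)
    (hX : ∀ M ∈ C.elements, ∀ i ∈ A M, IsUniqueAt (X M) i)
    {β : Finset (Fin n) → Finset (Finset (Fin n)) → ℝ}
    (hβ : ∀ M ∈ C.elements, ∀ S, A M ⊆ S → β S M = 0)
    (hβ1 : ∀ S, ∑ M ∈ C.elements, β S M ^ 2 ≤ 1) :
    IsFormBound (adversaryMatrix C X f β) (k + 1) := by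
  refine isFormBound_of_sum_sq_le (by positivity) fun b => ?_
  -- `v` extends `b` by zero to the positive inputs.
  let v : (Fin n → Fin q) → ℝ := fun y => if h : f y = false then b ⟨y, h⟩ else 0
  have hv : ∀ F : (Fin n → Fin q) → ℝ → ℝ, (∀ y, F y 0 = 0) →
      ∑ s : AdversaryColumn f, F s.1 (b s) = ∑ y, F y (v y) := by
    intro F hF
    rw [← Finset.sum_filter_of_ne (p := fun y => f y = false),
      Finset.sum_subtype (p := fun y => f y = false) _ (by simp)]
    · exact Finset.sum_congr rfl fun s _ => by simp only [v]; rw [dif_pos s.2]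
    · intro y _ hne
      by_contra hy
      simp only [v, dif_neg hy, hF, ne_eq, not_true_eq_false] at hne
  have hrow : ∀ r : AdversaryRow C X, ∑ s, adversaryMatrix C X f β r s * b s =
      √q * ∑ S, β S r.1 * proj S v r.2.1 := by
    intro r
    unfold adversaryMatrix
    refine (hv (fun y t => √q * (∑ S, β S r.1 * projKernel S r.2.1 y) * t) (by simp)).trans ?_
    simp only [proj, Finset.mul_sum, Finset.sum_mul]
    rw [Finset.sum_comm]
    exact Finset.sum_congr rfl fun S _ => Finset.sum_congr rfl fun y _ => by ring
  have hsq : ∀ t : ℝ, (√q * t) ^ 2 = q * t ^ 2 := fun t => by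
    rw [mul_pow, Real.sq_sqrt (Nat.cast_nonneg q)]
  simp only [hrow, hsq]
  rw [sum_adversaryRow fun M x => (q : ℝ) * (∑ S, β S M * proj S v x) ^ 2]
  simp only [← Finset.mul_sum]
  rw [Finset.mul_sum]
  have hM : ∀ M ∈ C.elements, (q : ℝ) * ∑ x ∈ X M, (∑ S, β S M * proj S v x) ^ 2 ≤
      k * ∑ S, β S M ^ 2 * projNormSq S v := by
    intro M hM
    refine (mul_sum_sq_sum_proj_le (hX M hM) (hβ M hM) v).trans ?_
    refine mul_le_mul_of_nonneg_right (by exact_mod_cast hk M hM) ?_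
    exact Finset.sum_nonneg fun S _ => mul_nonneg (sq_nonneg _) (projNormSq_nonneg S v)
  refine (Finset.sum_le_sum hM).trans ?_
  rw [← Finset.mul_sum, Finset.sum_comm]
  simp only [← Finset.sum_mul]
  rw [hv (fun _ t => t ^ 2) (by simp), ← sum_projNormSq]
  have h1 : ∑ S, (∑ M ∈ C.elements, β S M ^ 2) * projNormSq S v ≤ ∑ S, projNormSq S v :=
    Finset.sum_le_sum fun S _ => mul_le_of_le_one_left (projNormSq_nonneg S v) (hβ1 S)
  have h2 : 0 ≤ ∑ S, projNormSq S v := Finset.sum_nonneg fun S _ => projNormSq_nonneg S v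
  have hk0 : (0 : ℝ) ≤ k := Nat.cast_nonneg k
  nlinarith [mul_le_mul_of_nonneg_left h1 hk0, mul_nonneg hk0 h2, mul_nonneg hk0 (mul_nonneg hk0 h2)]

/-- The coefficients of the matrix that replaces the adversary matrix when `x_j` is queried. -/
def queryCoefficient (α : Finset (Fin n) → Finset (Finset (Fin n)) → ℝ) (j : Fin n)
    (S : Finset (Fin n)) (M : Finset (Finset (Fin n))) : ℝ :=
  if j ∈ S then 0 else α S M - α (insert j S) M

theorem sum_finset_eq_sum_notMem {ι : Type*} [Fintype ι] [DecidableEq ι] (j : ι)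
    (F : Finset ι → ℝ) :
    ∑ S, F S = ∑ S, if j ∈ S then 0 else F S + F (insert j S) := by
  have h : ∀ G : Finset ι → ℝ, ∑ S, G S =
      ∑ S ∈ (Finset.univ.erase j).powerset, (G S + G (insert j S)) := by
    intro G
    rw [Finset.sum_add_distrib, ← Finset.sum_powerset_insert (Finset.notMem_erase j _),
      Finset.insert_erase (Finset.mem_univ j), Finset.powerset_univ]
  rw [h, h]
  refine Finset.sum_congr rfl fun S hS => ?_
  have hj : j ∉ S := fun hj => by simpa using Finset.mem_powerset.1 hS hj
  simp [hj]

omit [NeZero q] in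
/-- Where `x_j ≠ y_j`, the kernels of `E_S` and `E_(S ∪ {j})` are opposite, so their coefficients can
be merged. -/
theorem adversaryMatrix_queryCoefficient (α : Finset (Fin n) → Finset (Finset (Fin n)) → ℝ)
    (j : Fin n) (r : AdversaryRow C X) (s : AdversaryColumn f) (h : r.2.1 j ≠ s.1 j) :
    adversaryMatrix C X f (queryCoefficient α j) r s = adversaryMatrix C X f α r s := by
  unfold adversaryMatrix
  rw [sum_finset_eq_sum_notMem j fun S => α S r.1 * projKernel S r.2.1 s.1]
  congr 1
  refine Finset.sum_congr rfl fun S _ => ?_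
  unfold queryCoefficient
  split_ifs with hj
  · rw [zero_mul]
  · rw [projKernel_insert hj h]; ring

end ArrayMatrix

/-- At least half of all inputs are negative, since each condition `x ∈ X_M` holds with probability
`1 / q`. -/
theorem card_negative_ge {n q : ℕ} [NeZero q] {C : CertificateStructure n}
    {A : Finset (Finset (Fin n)) → Finset (Fin n)}
    {X : Finset (Finset (Fin n)) → Finset (Fin n → Fin q)} {f : (Fin n → Fin q) → Bool}
    (hf : ∀ z, f z = true ↔ ∃ M ∈ C.elements, z ∈ X M) (hA : ∀ M ∈ C.elements, (A M).Nonempty)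
    (hX : ∀ M ∈ C.elements, ∀ i ∈ A M, IsUniqueAt (X M) i) (hq : 2 * C.elements.card ≤ q) :
    (q : ℝ) ^ n ≤ 2 * Fintype.card (AdversaryColumn f) := by
  have hq0 : (0 : ℝ) < q := Nat.cast_pos.2 (Nat.pos_of_ne_zero (NeZero.ne q))
  have hsub : (Finset.univ.filter fun z => f z = true) ⊆ C.elements.biUnion X := by
    intro z hz
    simpa using (hf z).1 (Finset.mem_filter.1 hz).2
  have h1 : ((Finset.univ.filter fun z => f z = true).card : ℝ) ≤ ∑ M ∈ C.elements, ((X M).card : ℝ) := by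
    exact_mod_cast (Finset.card_le_card hsub).trans Finset.card_biUnion_le
  have h2 : (q : ℝ) * ∑ M ∈ C.elements, ((X M).card : ℝ) = C.elements.card * (q : ℝ) ^ n := by
    rw [Finset.mul_sum, Finset.sum_congr rfl (g := fun _ => (q : ℝ) ^ n), Finset.sum_const,
      nsmul_eq_mul]
    intro M hM
    obtain ⟨i, hi⟩ := hA M hM
    simpa using (hX M hM i hi).mul_card
  have h3 : ((Finset.univ.filter fun z => f z = true).card : ℝ) +
      Fintype.card (AdversaryColumn f) = (q : ℝ) ^ n := by
    have h4 := Finset.card_filter_add_card_filter_not (s := (Finset.univ : Finset (Fin n → Fin q)))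
      (fun z => f z = true)
    simp only [Bool.not_eq_true] at h4
    rw [Fintype.card_subtype]
    have h5 : (Finset.univ : Finset (Fin n → Fin q)).card = q ^ n := by simp
    rw [h5] at h4
    exact_mod_cast h4
  have h6 : (2 * C.elements.card : ℝ) ≤ q := by exact_mod_cast hq
  have h7 : (0 : ℝ) < (q : ℝ) ^ n := by positivity
  have h8 : (q : ℝ) * (2 * ((Finset.univ.filter fun z => f z = true).card : ℝ)) ≤ q * (q : ℝ) ^ n := by
    nlinarith [mul_le_mul_of_nonneg_left h1 hq0.le]
  have h9 := le_of_mul_le_mul_left h8 hq0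
  linarith

/-- The uniform distribution on `X_M` has no component in the range of `E_S` unless `S = ∅` or
`A ⊆ S`, so that the sum over the rows in `X_M` leaves only the coefficient of `E_∅`. -/
theorem mul_sum_sum_projKernel {n q : ℕ} [NeZero q] {A : Finset (Fin n)}
    {X : Finset (Fin n → Fin q)} (hX : ∀ i ∈ A, IsUniqueAt X i) {β : Finset (Fin n) → ℝ}
    (hβ : ∀ S, A ⊆ S → β S = 0) (y : Fin n → Fin q) :
    q * ∑ x ∈ X, ∑ S, β S * projKernel S x y = β ∅ := by
  have h : ∀ S, q * ∑ x ∈ X, β S * projKernel S x y = if S = ∅ then β S else 0 := by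
    intro S
    by_cases hA : A ⊆ S
    · simp [hβ S hA]
    · obtain ⟨i, hi, hiS⟩ := Finset.not_subset.1 hA
      rw [← Finset.mul_sum, mul_left_comm, sum_projKernel_of_isUniqueAt (hX i hi) hiS]
      simp
  rw [Finset.sum_comm, Finset.mul_sum]
  simp [h]

/-- Every dual feasible point gives a lower bound on the number of queries: the adversary matrix
with the coefficients `α_S(M)` is evaluated at the vectors that are uniform on each `X_M`, with
weights proportional to `α_∅(M)`, and uniform on the negative inputs. -/
theorem sqrt_sum_sq_le_of_evaluates {n q T k : ℕ} [NeZero q] {C : CertificateStructure n}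
    {A : Finset (Finset (Fin n)) → Finset (Fin n)}
    (hA : ∀ M ∈ C.elements, M = supersets (A M) ∧ (A M).Nonempty)
    (hk : ∀ M ∈ C.elements, (A M).card ≤ k)
    {X : Finset (Finset (Fin n)) → Finset (Fin n → Fin q)} {f : (Fin n → Fin q) → Bool}
    (hf : ∀ z, f z = true ↔ ∃ M ∈ C.elements, z ∈ X M)
    (hX : ∀ M ∈ C.elements, ∀ i ∈ A M, IsUniqueAt (X M) i) (hq : 2 * C.elements.card ≤ q)
    {α : Finset (Fin n) → Finset (Finset (Fin n)) → ℝ} (hα : IsDualFeasible C α)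
    (𝒜 : QuantumQueryAlgorithm n q T) (h𝒜 : 𝒜.Evaluates f) :
    √(∑ M ∈ C.elements, α ∅ M ^ 2) ≤ 80 * (k + 1) * T := by
  have hq0 : (0 : ℝ) < q := Nat.cast_pos.2 (Nat.pos_of_ne_zero (NeZero.ne q))
  have hα0 : ∀ M ∈ C.elements, ∀ S, A M ⊆ S → α S M = 0 := by
    intro M hM S hS
    refine hα.eq_zero_of_mem M hM S ?_
    rw [(hA M hM).1]
    simpa [supersets] using hS
  set Λ := √(∑ M ∈ C.elements, α ∅ M ^ 2) with hΛ
  have hΛ2 : Λ ^ 2 = ∑ M ∈ C.elements, α ∅ M ^ 2 :=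
    Real.sq_sqrt (Finset.sum_nonneg fun _ _ => sq_nonneg _)
  rcases (show 0 ≤ Λ from Real.sqrt_nonneg _).eq_or_lt with h0 | hΛ0
  · rw [← h0]; positivity
  set Q : ℝ := (q : ℝ) ^ n with hQ
  have hQ0 : 0 < Q := by positivity
  have hQs : √Q ^ 2 = Q := Real.sq_sqrt hQ0.le
  have hqs : √(q : ℝ) ^ 2 = q := Real.sq_sqrt hq0.le
  have hQs0 : 0 < √Q := Real.sqrt_pos.2 hQ0
  have hcard : ∀ M ∈ C.elements, (q : ℝ) * (X M).card = Q := by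
    intro M hM
    obtain ⟨i, hi⟩ := (hA M hM).2
    simpa [hQ] using (hX M hM i hi).mul_card
  have hneg : Q ≤ 2 * Fintype.card (AdversaryColumn f) :=
    card_negative_ge hf (fun M hM => (hA M hM).2) hX hq
  have hcol : (Fintype.card (AdversaryColumn f) : ℝ) ≤ Q := by
    have := Fintype.card_subtype_le fun y : Fin n → Fin q => f y = false
    rw [Fintype.card_fun, Fintype.card_fin, Fintype.card_fin] at this
    rw [hQ]
    exact_mod_cast this
  let a : AdversaryRow C X → ℝ := fun r => α ∅ r.1 / Λ * (√q / √Q)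
  let b : AdversaryColumn f → ℝ := fun _ => 1 / √Q
  have ha : ∑ r, a r ^ 2 = 1 := by
    refine (sum_adversaryRow fun M _ => (α ∅ M / Λ * (√q / √Q)) ^ 2).trans ?_
    rw [Finset.sum_congr rfl (g := fun M => α ∅ M ^ 2 / Λ ^ 2), ← Finset.sum_div, ← hΛ2,
      div_self (by positivity)]
    intro M hM
    rw [Finset.sum_const, nsmul_eq_mul, mul_pow, div_pow, div_pow, hqs, hQs]
    have := hcard M hM
    rw [← this]
    have hX0 : ((X M).card : ℝ) ≠ 0 := by
      intro h
      rw [h, mul_zero] at this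
      exact hQ0.ne this
    field_simp
  have hb : ∑ s, b s ^ 2 ≤ 1 := by
    simp only [b, div_pow, hQs, Finset.sum_const, nsmul_eq_mul, one_pow, Finset.card_univ]
    rw [mul_one_div, div_le_one hQ0]
    exact hcol
  have hmain := 𝒜.adversary_bound (fun r : AdversaryRow C X => r.2.1)
    (fun s : AdversaryColumn f => s.1) h𝒜 (fun r => (hf _).2 ⟨r.1, r.1.2, r.2.2⟩) (fun s => s.2)
    (adversaryMatrix C X f α) (fun j => adversaryMatrix C X f (queryCoefficient α j))
    (K := k + 1) (by positivity)
    (fun j r s h => adversaryMatrix_queryCoefficient f α j r s h)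
    (fun j => isFormBound_adversaryMatrix f hk hX
      (fun M hM S hS => by
        unfold queryCoefficient
        rw [hα0 M hM S hS, hα0 M hM _ (hS.trans (Finset.subset_insert _ _)), sub_zero, ite_self])
      (fun S => by
        unfold queryCoefficient
        split_ifs with hj
        · simp
        · exact hα.sum_sq_sub_le S j hj))
    a b (by linarith)
  have hval : ∑ r, ∑ s, adversaryMatrix C X f α r s * (a r * b s) =
      Fintype.card (AdversaryColumn f) * (Λ / Q) := by
    rw [Finset.sum_comm]
    have hs : ∀ s : AdversaryColumn f, ∑ r, adversaryMatrix C X f α r s * (a r * b s) = Λ / Q := by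
      intro s
      refine (sum_adversaryRow fun M x => √q * (∑ S, α S M * projKernel S x s.1) *
        (α ∅ M / Λ * (√q / √Q) * (1 / √Q))).trans ?_
      have hM : ∀ M ∈ C.elements, ∑ x ∈ X M, √q * (∑ S, α S M * projKernel S x s.1) *
          (α ∅ M / Λ * (√q / √Q) * (1 / √Q)) = α ∅ M ^ 2 / (Λ * Q) := by
        intro M hM
        rw [← Finset.sum_mul, ← Finset.mul_sum]
        have h1 := mul_sum_sum_projKernel (hX M hM) (hα0 M hM) s.1
        set Z := ∑ x ∈ X M, ∑ S, α S M * projKernel S x s.1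
        have h2 : √q * Z * (α ∅ M / Λ * (√q / √Q) * (1 / √Q)) =
            (√q ^ 2 * Z) * α ∅ M / (Λ * √Q ^ 2) := by
          field_simp
        rw [h2, hqs, hQs, h1, ← pow_two]
      rw [Finset.sum_congr rfl hM, ← Finset.sum_div, ← hΛ2, pow_two, mul_div_mul_left _ _ hΛ0.ne']
    rw [Finset.sum_congr rfl fun s _ => hs s, Finset.sum_const, nsmul_eq_mul, Finset.card_univ]
  rw [hval] at hmain
  have hhalf : Λ / 2 ≤ Fintype.card (AdversaryColumn f) * (Λ / Q) := by
    rw [mul_div_assoc', div_le_div_iff₀ two_pos hQ0]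
    nlinarith
  linarith

/-! ### Array functions and sum functions -/

theorem supersets_injective {n : ℕ} : Function.Injective (supersets (n := n)) := by
  intro S T h
  have h1 : S ∈ supersets T := h ▸ by simp [supersets]
  have h2 : T ∈ supersets S := h ▸ by simp [supersets]
  simp only [supersets, Finset.mem_filter, Finset.mem_univ, true_and] at h1 h2
  exact h2.antisymm h1

/-- An infimum over algorithms is attained or, in the absence of algorithms, infinite. -/
theorem le_quantumQueryComplexity {n q : ℕ} [NeZero q] {f : (Fin n → Fin q) → Bool} {a : ℝ≥0∞}
    (h : ∀ (T : ℕ) (𝒜 : QuantumQueryAlgorithm n q T), 𝒜.Evaluates f → a ≤ T) :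
    a ≤ (quantumQueryComplexity f : ℝ≥0∞) := by
  unfold quantumQueryComplexity
  obtain ⟨T, hT⟩ := ENat.exists_eq_iInf
    (fun T : ℕ => ⨅ (_ : ∃ 𝒜 : QuantumQueryAlgorithm n q T, 𝒜.Evaluates f), (T : ℕ∞))
  rw [← hT]
  by_cases hT' : ∃ 𝒜 : QuantumQueryAlgorithm n q T, 𝒜.Evaluates f
  · obtain ⟨𝒜, h𝒜⟩ := hT'
    rw [iInf_pos ⟨𝒜, h𝒜⟩]
    simpa using h T 𝒜 h𝒜
  · rw [iInf_neg hT']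
    simp

/-- Orthogonal arrays of length `|A|` and size `q^(|A|-1)` are those in which each entry is
determined by the others, and this property passes to the set of inputs that they define. -/
theorem isUniqueAt_of_isOrthogonalArray {n q : ℕ} {A : Finset (Fin n)} {T : Finset (A → Fin q)}
    (hq : 0 < q) (hT : IsOrthogonalArray T) (hcard : T.card = q ^ (A.card - 1))
    {i : Fin n} (hi : i ∈ A) :
    IsUniqueAt (Finset.univ.filter fun x : Fin n → Fin q => (fun j : A => x j) ∈ T) i := by
  intro x
  have h := hT ⟨i, hi⟩ fun j => x j
  rw [hcard, Fintype.card_coe] at h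
  have h1 := Nat.eq_of_mul_eq_mul_right (pow_pos hq _) (h.trans (one_mul _).symm)
  rw [← h1]
  congr 1
  ext a
  have hup : (fun j : A => Function.update x i a j) =
      Function.update (fun j : A => x j) ⟨i, hi⟩ a := by
    funext j
    by_cases hj : j = ⟨i, hi⟩
    · subst hj; simp
    · rw [Function.update_of_ne hj, Function.update_of_ne fun h => hj (Subtype.ext h)]
  simp [hup]

/-- The solutions of `∑ x_j ≡ 0 (mod q)`. -/
def sumArray (ι : Type) [Fintype ι] [DecidableEq ι] (q : ℕ) : Finset (ι → Fin q) :=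
  Finset.univ.filter fun x => q ∣ ∑ j, (x j : ℕ)

/-- The other entries determine the residue of `x_i` modulo `q`. -/
theorem isUniqueAt_sumArray {ι : Type} [Fintype ι] [DecidableEq ι] {q : ℕ} [NeZero q] (i : ι) :
    IsUniqueAt (sumArray ι q) i := by
  intro x
  have hq : 0 < q := Nat.pos_of_ne_zero (NeZero.ne q)
  set s := ∑ j ∈ Finset.univ.erase i, (x j : ℕ) with hs
  have hsum : ∀ a : Fin q, ∑ j, (Function.update x i a j : ℕ) = a + s := by
    intro a
    rw [← Finset.add_sum_erase _ _ (Finset.mem_univ i), Function.update_self]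
    congr 1
    exact Finset.sum_congr rfl fun j hj => by rw [Function.update_of_ne (Finset.ne_of_mem_erase hj)]
  let a₀ : Fin q := ⟨(q - s % q) % q, Nat.mod_lt _ hq⟩
  have ha₀ : q ∣ (a₀ : ℕ) + s := by
    have h1 := Nat.mod_lt s hq
    have h2 := Nat.mod_add_div s q
    have h3 : q - s % q + s = q + q * (s / q) := by omega
    rw [Nat.dvd_iff_mod_eq_zero]
    simp only [a₀]
    rw [Nat.mod_add_mod, h3]
    simp
  rw [Finset.card_eq_one]
  refine ⟨a₀, Finset.ext fun a => ?_⟩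
  simp only [sumArray, Finset.mem_filter, Finset.mem_univ, true_and, hsum, Finset.mem_singleton]
  constructor
  · intro h
    have hmod : (a : ℕ) + s ≡ a₀ + s [MOD q] :=
      ((Nat.modEq_zero_iff_dvd.2 h).trans (Nat.modEq_zero_iff_dvd.2 ha₀).symm)
    exact Fin.ext ((Nat.ModEq.add_right_cancel' s hmod).eq_of_lt_of_lt a.2 a₀.2)
  · rintro rfl
    exact ha₀

theorem card_sumArray {ι : Type} [Fintype ι] [DecidableEq ι] [Nonempty ι] {q : ℕ} [NeZero q] :
    (sumArray ι q).card = q ^ (Fintype.card ι - 1) := by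
  obtain ⟨i⟩ := ‹Nonempty ι›
  have h := (isUniqueAt_sumArray (q := q) i).mul_card
  have h' : q * (sumArray ι q).card = q ^ Fintype.card ι := by exact_mod_cast h
  have hpos : 0 < Fintype.card ι := Fintype.card_pos_iff.2 ⟨i⟩
  refine Nat.eq_of_mul_eq_mul_left (Nat.pos_of_ne_zero (NeZero.ne q)) (h'.trans ?_)
  rw [← pow_succ', Nat.sub_add_cancel hpos]

theorem isOrthogonalArray_sumArray {ι : Type} [Fintype ι] [DecidableEq ι] {q : ℕ} [NeZero q] :
    IsOrthogonalArray (sumArray ι q) := by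
  intro i x
  have : Nonempty ι := ⟨i⟩
  rw [isUniqueAt_sumArray i x, one_mul, card_sumArray]

theorem sumFunction_eq_arrayFunction {n q : ℕ} (C : CertificateStructure n)
    (A : Finset (Finset (Fin n)) → Finset (Fin n)) :
    sumFunction (q := q) C A = arrayFunction C A fun M => sumArray (A M) q := by
  funext x
  unfold sumFunction arrayFunction
  congr 1
  simp only [sumArray, Finset.mem_filter, Finset.mem_univ, true_and]
  refine propext (exists_congr fun M => and_congr_right fun _ => ?_)
  rw [Finset.sum_coe_sort (A M) fun j => (x j : ℕ)]

/-- Learning graph duality combined with the adversary bound; letting the slack `η` of the duality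
tend to `0` gives the constant `1 / (80 (k + 1))`. -/
theorem learningGraphComplexity_le_arrayFunction {k n q : ℕ} [NeZero q]
    {C : CertificateStructure n} (hC : C.IsBoundedlyGenerated k) (hq : 2 * C.elements.card ≤ q)
    {A : Finset (Finset (Fin n)) → Finset (Fin n)}
    (hA : ∀ M ∈ C.elements, M = supersets (A M) ∧ (A M).Nonempty)
    {T : (M : Finset (Finset (Fin n))) → Finset (A M → Fin q)}
    (hT : ∀ M ∈ C.elements, IsOrthogonalArray (T M) ∧ (T M).card = q ^ ((A M).card - 1)) :
    ENNReal.ofReal (1 / (80 * (k + 1))) * learningGraphComplexity C ≤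
      (quantumQueryComplexity (arrayFunction C A T) : ℝ≥0∞) := by
  have hq0 : 0 < q := Nat.pos_of_ne_zero (NeZero.ne q)
  have hk : ∀ M ∈ C.elements, (A M).card ≤ k := by
    intro M hM
    obtain ⟨𝒮, rfl, h𝒮⟩ := hC
    obtain ⟨S, hS, hSM⟩ := Finset.mem_image.1 (show M ∈ 𝒮.image supersets from hM)
    rw [← supersets_injective (hSM.trans (hA M hM).1)]
    exact h𝒮 S hS
  have hempty : ∀ M ∈ C.elements, ∅ ∉ M := by
    intro M hM h
    rw [(hA M hM).1] at h
    simp only [supersets, Finset.mem_filter, Finset.subset_empty] at h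
    exact (hA M hM).2.ne_empty h.2
  refine le_quantumQueryComplexity fun t 𝒜 h𝒜 => ?_
  have hB : (0 : ℝ) ≤ 80 * (k + 1) * t := by positivity
  have hL : learningGraphComplexity C ≤ ENNReal.ofReal (80 * (k + 1) * t) := by
    refine ENNReal.le_of_forall_pos_le_add fun η hη _ => ?_
    have hη' : (0 : ℝ) < η := hη
    obtain ⟨α, hα, hle⟩ := exists_dualFeasible_learningGraphComplexity_le hempty
      (show (0 : ℝ) < (η : ℝ) ^ 2 by positivity)
    refine hle.trans ?_
    have hbound := sqrt_sum_sq_le_of_evaluates hA hk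
      (X := fun M => Finset.univ.filter fun x : Fin n → Fin q => (fun j : A M => x j) ∈ T M)
      (fun z => by simp [arrayFunction])
      (fun M hM i hi => isUniqueAt_of_isOrthogonalArray hq0 (hT M hM).1 (hT M hM).2 hi) hq hα 𝒜 h𝒜
    rw [← ENNReal.ofReal_coe_nnreal, ← ENNReal.ofReal_add hB η.coe_nonneg]
    refine ENNReal.ofReal_le_ofReal ?_
    rw [Real.sqrt_le_left (by positivity)] at hbound ⊢
    nlinarith
  refine (mul_le_mul_right hL _).trans ?_
  rw [← ENNReal.ofReal_mul (by positivity), ← ENNReal.ofReal_natCast]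
  refine ENNReal.ofReal_le_ofReal (le_of_eq ?_)
  field_simp

theorem mainTheorem2 (k : ℕ) :
    ∃ c : ℝ, 0 < c ∧
      ∀ (n q : ℕ) [NeZero q] (C : CertificateStructure n),
        C.IsBoundedlyGenerated k →
        2 * C.elements.card ≤ q →
        ∀ A : Finset (Finset (Fin n)) → Finset (Fin n),
          (∀ M ∈ C.elements, M = supersets (A M) ∧ (A M).Nonempty) →
          (∀ T : (M : Finset (Finset (Fin n))) → Finset (A M → Fin q),
            (∀ M ∈ C.elements,
              IsOrthogonalArray (T M) ∧ (T M).card = q ^ ((A M).card - 1)) →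
            ENNReal.ofReal c * learningGraphComplexity C ≤
              (quantumQueryComplexity (arrayFunction C A T) : ℝ≥0∞)) ∧
          ENNReal.ofReal c * learningGraphComplexity C ≤
            (quantumQueryComplexity (sumFunction (q := q) C A) : ℝ≥0∞) := by
  refine ⟨1 / (80 * (k + 1)), by positivity, fun n q _ C hC hq A hA => ⟨fun T hT => ?_, ?_⟩⟩
  · exact learningGraphComplexity_le_arrayFunction hC hq hA hT
  · rw [sumFunction_eq_arrayFunction]
    refine learningGraphComplexity_le_arrayFunction hC hq hA fun M hM => ?_
    obtain ⟨j, hj⟩ := (hA M hM).2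
    have : Nonempty (A M) := ⟨⟨j, hj⟩⟩
    exact ⟨isOrthogonalArray_sumArray, by rw [card_sumArray, Fintype.card_coe]⟩
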